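/- Let $\Gamma$ be a polar space of finite rank $n\ge 3$: a partial linear space, all of whose lines have at least three points, such that for every point $p$ and line $L$ either all points or exactly one point of $L$ is collinear to $p$ (a point being collinear to itself), no point is collinear to all points, and every nested family of singular subspaces is finite; its maximal singular subspaces have projective dimension $n-1$. Call $\Gamma$ of type $\mathsf D_n$ (hyperbolic) if every singular subspace of dimension $n-2$ lies in exactly two maximal singular subspaces, and of type $\mathsf B_n$ otherwise. Two nonempty singular subspaces are opposite if no point of either is collinear to all points of the other. Two lines are coplanar if they are contained in a common singular subspace of projective dimension $2$. A collineation is a permutation of the points preserving the set of lines. It is a linewise $\{2,2'\}$-kangaroo if it maps every line to a coplanar (possibly equal) line or to an opposite line, and it is anisotropic if it maps every chamber of the associated building to an opposite chamber. Let $\theta$ be a non-trivial collineation of $\Gamma$. Then: (i) $\theta$ is a linewise $\{2,2'\}$-kangaroo if and only if either $\theta$ is anisotropic, or among all nonempty singular subspaces only lines are mapped by $\theta$ to opposites. (ii) If $\theta$ is a linewise $\{2,2'\}$-kangaroo and is not anisotropic, then its opposition diagram is $\mathsf B_{n;1}^2$ if $\Gamma$ has type $\mathsf B_n$, and $\mathsf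 D_{n;1}^2$ if $\Gamma$ has type $\mathsf D_n$. Here the opposition diagram of $\theta$ is the triple $(\Pi,J,\varphi)$, where $\Pi$ is the Coxeter diagram of the building of $\Gamma$, $J$ consists precisely of the types of the minimal simplices that $\theta$ maps to opposite simplices, and $\varphi$ is the automorphism of $\Pi$ such that $\theta$ induces $\varphi\sigma_0$ on the types, with $\sigma_0$ the opposition relation (the automorphism of $\Pi$ induced by the longest element of the Coxeter group). With nodes labelled $1,\dots,n$ as in Bourbaki, $\mathsf B_{n;1}^2$ is the diagram $\mathsf B_n$ with $\varphi=\mathrm{id}$ and $J=\{\{2\}\}$; and $\mathsf D_{n;1}^2$ is the diagram $\mathsf D_n$ in which $\varphi$ is trivial if $n$ is even and interchanges the nodes $n-1$ and $n$ if $n$ is odd, and $J$ consists of the single $\varphi$-orbit of the node $2$ (so $J=\{\{2\}\}$ for $n\ge4$ and $J=\{\{2,3\}\}$ for $n=3$). -/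

import Mathlib

/-- A polar space (Buekenhout–Shult axioms) with point set `P`: a partial linear space all of whose
lines have at least three points, satisfying the one-or-all axiom, in which no point is collinear to
all points and every nested family of singular subspaces is finite. -/
structure PolarSpace (P : Type*) where
  lines : Set (Set P)
  three_le_line : ∀ L ∈ lines, 3 ≤ L.encard
  line_unique : ∀ L ∈ lines, ∀ M ∈ lines, ∀ x y : P, x ≠ y →
    x ∈ L → y ∈ L → x ∈ M → y ∈ M → L = M
  /-- For a point `p` and a line `L`, all points of `L`, or exactly one of them, are collinear to `p`
  (a point counts as collinear to itself). -/
  one_or_all : ∀ (p : P), ∀ L ∈ lines,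
    (∀ x ∈ L, p = x ∨ ∃ M ∈ lines, p ∈ M ∧ x ∈ M) ∨
    (∃! x, x ∈ L ∧ (p = x ∨ ∃ M ∈ lines, p ∈ M ∧ x ∈ M))
  nondegenerate : ∀ p : P, ∃ q : P, ¬ (p = q ∨ ∃ M ∈ lines, p ∈ M ∧ q ∈ M)
  finite_chains : ∀ C : Set (Set P),
    (∀ U ∈ C,
      (∀ L ∈ lines, ∀ x ∈ L, ∀ y ∈ L, x ≠ y → x ∈ U → y ∈ U → L ⊆ U) ∧
      (∀ x ∈ U, ∀ y ∈ U, x = y ∨ ∃ M ∈ lines, x ∈ M ∧ y ∈ M)) →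
    IsChain (· ⊆ ·) C → C.Finite

/-- A Coxeter diagram with nodes `Fin n` (node `i` has Bourbaki label `i + 1`), given by its Coxeter
matrix, together with a permutation of the nodes and a set of distinguished sets of nodes. -/
structure DecoratedDiagram (n : ℕ) where
  coxeter : CoxeterMatrix (Fin n)
  twist : Equiv.Perm (Fin n)
  distinguished : Set (Set (Fin n))

/-- The Coxeter matrix of type `D_n` (Bourbaki labelling, shifted by one): the path
`0, 1, …, n - 2`, and the node `n - 1` joined to `n - 3` only. (In the installed Mathlib
`CoxeterMatrix.D` also joins the last two nodes to each other.) -/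
def coxeterD (n : ℕ) : CoxeterMatrix (Fin n) where
  M := Matrix.of fun i j : Fin n ↦
    if i = j then 1
    else if (i.val + 1 = j.val ∧ j.val + 1 < n) ∨ (j.val + 1 = i.val ∧ i.val + 1 < n) ∨
        (i.val + 2 = j.val ∧ j.val + 1 = n) ∨ (j.val + 2 = i.val ∧ i.val + 1 = n) then 3
    else 2
  isSymm := by
    ext i j
    simp only [Matrix.transpose_apply, Matrix.of_apply]
    congr 1
    · simp [eq_comm]
    · congr 1
      apply propext
      tauto
  diagonal := by simp
  off_diagonal := by
    intro i j h
    simp only [Matrix.of_apply, if_neg h]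
    split_ifs <;> simp

/-- The permutation of the nodes that interchanges the last two of them. -/
def swapLastTwo (n : ℕ) : Equiv.Perm (Fin n) :=
  if h : 2 ≤ n then Equiv.swap ⟨n - 2, by omega⟩ ⟨n - 1, by omega⟩ else 1

/-- The diagram `B_{n;1}^2`: untwisted, and exactly the node with label 2 is encircled. -/
def diagramB (n : ℕ) : DecoratedDiagram n where
  coxeter := CoxeterMatrix.B n
  twist := 1
  distinguished := {{i | i.val = 1}}

/-- The diagram `D_{n;1}^2`: the last two nodes are interchanged precisely when `n` is odd, and
exactly the orbit of the node with label 2 is encircled. (For `n ≥ 4` that orbit is the node with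
label 2 alone; for `n = 3` it consists of the nodes with labels 2 and 3.) -/
noncomputable def diagramD (n : ℕ) : DecoratedDiagram n where
  coxeter := coxeterD n
  twist := if Even n then 1 else swapLastTwo n
  distinguished :=
    {{j | ∃ i : Fin n, i.val = 1 ∧ (if Even n then 1 else swapLastTwo n).SameCycle i j}}

namespace PolarSpace

variable {P : Type*} (Γ : PolarSpace P)

/-- Collinearity `p ⊥ q`; a point is collinear to itself. -/
def Collinear (p q : P) : Prop := p = q ∨ ∃ M ∈ Γ.lines, p ∈ M ∧ q ∈ M

/-- A subspace contains every line that has two distinct points in it. -/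
def IsSubspace (U : Set P) : Prop :=
  ∀ L ∈ Γ.lines, ∀ x ∈ L, ∀ y ∈ L, x ≠ y → x ∈ U → y ∈ U → L ⊆ U

/-- A singular subspace: a subspace any two points of which are collinear. -/
def IsSingular (U : Set P) : Prop :=
  Γ.IsSubspace U ∧ ∀ x ∈ U, ∀ y ∈ U, Γ.Collinear x y

/-- The rank of a singular subspace `U`, that is, its projective dimension plus one: the greatest
length of a chain of nonempty singular subspaces contained in `U`. Points have rank 1, lines have
rank 2, planes have rank 3. -/
noncomputable def rk (U : Set P) : ℕ∞ :=
  Set.chainHeight {V : Set P | Γ.IsSingular V ∧ V.Nonempty ∧ V ⊆ U} (· ⊆ ·)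

def IsMaximalSingular (U : Set P) : Prop := Maximal Γ.IsSingular U

/-- The polar space has rank `n`: its maximal singular subspaces have projective dimension
`n - 1`. -/
def HasRank (n : ℕ) : Prop := ∀ U, Γ.IsMaximalSingular U → Γ.rk U = n

/-- The polar space (of rank `n`) is hyperbolic, that is, its building has type `D_n`: every
submaximal singular subspace lies in exactly two maximal singular subspaces. Otherwise its building
has type `B_n`. -/
def IsHyperbolic (n : ℕ) : Prop :=
  ∀ U, Γ.IsSingular U → Γ.rk U + 1 = n → {M | Γ.IsMaximalSingular M ∧ U ⊆ M}.encard = 2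

/-- A collineation: a permutation of the points preserving the set of lines. -/
def IsCollineation (θ : Equiv.Perm P) : Prop :=
  ∀ L : Set P, θ '' L ∈ Γ.lines ↔ L ∈ Γ.lines

/-- Two singular subspaces are opposite if no point of one is collinear to all points of the
other. -/
def Opposite (U V : Set P) : Prop :=
  (∀ x ∈ U, ∃ y ∈ V, ¬ Γ.Collinear x y) ∧ (∀ y ∈ V, ∃ x ∈ U, ¬ Γ.Collinear x y)

/-- Two lines are coplanar if some singular subspace of projective dimension 2 contains both. -/
def Coplanar (L M : Set P) : Prop :=
  ∃ U, Γ.IsSingular U ∧ Γ.rk U = 3 ∧ L ⊆ U ∧ M ⊆ U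

/-- Every line is mapped to a coplanar (possibly equal) or to an opposite line. -/
def IsLinewiseKangaroo (θ : Equiv.Perm P) : Prop :=
  ∀ L ∈ Γ.lines, Γ.Coplanar L (θ '' L) ∨ Γ.Opposite L (θ '' L)

/-- Among all (nonempty) singular subspaces, only lines are mapped to opposites. -/
def OnlyLinesToOpposite (θ : Equiv.Perm P) : Prop :=
  ∀ U : Set P, Γ.IsSingular U → U.Nonempty → Γ.Opposite U (θ '' U) → U ∈ Γ.lines

/-! ### The building of a polar space of rank `n` -/

/-- The vertices of the building: all nonempty singular subspaces, except that the submaximal ones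
are left out in the hyperbolic case. -/
def IsVertex (n : ℕ) (U : Set P) : Prop :=
  Γ.IsSingular U ∧ U.Nonempty ∧ (Γ.IsHyperbolic n → Γ.rk U + 1 ≠ n)

/-- Incidence of vertices is inclusion; in the hyperbolic case, two maximal singular subspaces
meeting in a submaximal one are also incident. -/
def Incident (n : ℕ) (U V : Set P) : Prop :=
  U ⊆ V ∨ V ⊆ U ∨
    (Γ.IsHyperbolic n ∧ Γ.IsMaximalSingular U ∧ Γ.IsMaximalSingular V ∧ Γ.rk (U ∩ V) + 1 = n)

/-- The simplices of the building, as sets of pairwise incident vertices. -/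
def IsSimplex (n : ℕ) (S : Set (Set P)) : Prop :=
  (∀ U ∈ S, Γ.IsVertex n U) ∧ ∀ U ∈ S, ∀ V ∈ S, Γ.Incident n U V

/-- The chambers are the maximal simplices. -/
def IsChamber (n : ℕ) (S : Set (Set P)) : Prop := Maximal (Γ.IsSimplex n) S

/-- Two simplices are opposite if each vertex of either is opposite some vertex of the other. -/
def OppositeSimplices (S T : Set (Set P)) : Prop :=
  (∀ U ∈ S, ∃ V ∈ T, Γ.Opposite U V) ∧ (∀ V ∈ T, ∃ U ∈ S, Γ.Opposite U V)

/-- The image of a simplex under a permutation of the points. -/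
def imageSimplex (θ : Equiv.Perm P) (S : Set (Set P)) : Set (Set P) := (fun U => θ '' U) '' S

/-- Anisotropic: every chamber is mapped to an opposite chamber. -/
def IsAnisotropic (n : ℕ) (θ : Equiv.Perm P) : Prop :=
  ∀ S, Γ.IsChamber n S → Γ.OppositeSimplices S (imageSimplex θ S)

open scoped Classical in
/-- The Coxeter matrix of the building. -/
noncomputable def coxeterMatrix (n : ℕ) : CoxeterMatrix (Fin n) :=
  if Γ.IsHyperbolic n then coxeterD n else CoxeterMatrix.B n

open scoped Classical in
/-- The opposition relation on the types, induced by the longest element of the Coxeter group: it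
interchanges the last two nodes in type `D_n` with `n` odd, and is trivial for type `B_n` and for
type `D_n` with `n` even. -/
noncomputable def oppositionRelation (n : ℕ) : Equiv.Perm (Fin n) :=
  if Γ.IsHyperbolic n ∧ Odd n then swapLastTwo n else 1

/-- The vertex `U` has type `i`. In the non-hyperbolic case, and for vertices that are not maximal
singular subspaces, the type is the projective dimension. In the hyperbolic case the maximal singular
subspaces fall into two families, according to the parity of the codimension of the intersection
with a reference maximal singular subspace `M₀`; those in the family of `M₀` get the last type
`n - 1`, the others get type `n - 2`. -/
def HasType (n : ℕ) (M₀ U : Set P) (i : Fin n) : Prop :=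
  Γ.IsVertex n U ∧
    (((Γ.IsHyperbolic n → ¬ Γ.IsMaximalSingular U) ∧ Γ.rk U = (i.val + 1 : ℕ)) ∨
     (Γ.IsHyperbolic n ∧ Γ.IsMaximalSingular U ∧
       ((i.val + 1 = n ∧ ∃ k : ℕ, Γ.rk (U ∩ M₀) + (2 * k : ℕ) = n) ∨
        (i.val + 2 = n ∧ ∃ k : ℕ, Γ.rk (U ∩ M₀) + (2 * k + 1 : ℕ) = n))))

/-- `σ` is the permutation of the types induced by `θ`. -/
def IsCompanion (n : ℕ) (M₀ : Set P) (θ : Equiv.Perm P) (σ : Equiv.Perm (Fin n)) : Prop :=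
  ∀ U i, Γ.HasType n M₀ U i → Γ.HasType n M₀ (θ '' U) (σ i)

/-- A nonempty simplex that is mapped to an opposite one. -/
def SentToOpposite (n : ℕ) (θ : Equiv.Perm P) (S : Set (Set P)) : Prop :=
  Γ.IsSimplex n S ∧ S.Nonempty ∧ Γ.OppositeSimplices S (imageSimplex θ S)

/-- `X = (Π, J, φ)` is the opposition diagram of `θ`: `Π` is the diagram of the building, the
permutation of the types induced by `θ` is `φ` composed with the opposition relation, and `J`
consists precisely of the types of the minimal simplices sent to opposites. -/
def IsOppositionDiagram (n : ℕ) (M₀ : Set P) (θ : Equiv.Perm P) (X : DecoratedDiagram n) : Prop :=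
  X.coxeter = Γ.coxeterMatrix n ∧
  Γ.IsCompanion n M₀ θ (X.twist * Γ.oppositionRelation n) ∧
  X.distinguished =
    {T | ∃ S, Minimal (Γ.SentToOpposite n θ) S ∧ T = {i | ∃ U ∈ S, Γ.HasType n M₀ U i}}

end PolarSpace

namespace PolarSpace

variable {P : Type*} {Γ : PolarSpace P}

/-! Write `x ⊥ y` for collinearity. A collineation is anisotropic exactly when no point satisfies `x
⊥ θ x`. For a kangaroo, the property "`p` is not collinear to `θ p`" spreads from `p` to every point
collinear to `p`, hence to all points, since any two points have a common neighbour. So a kangaroo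
that is not anisotropic satisfies `x ⊥ θ x` everywhere.

From then on, `x ⊥ θ y` behaves on a singular subspace `U` like an alternating form: it is symmetric
(`collinear_image_symm`), every point is isotropic, a line is either totally isotropic or opposite
its image (`collinear_of_not_opposite`), and `U` is opposite `θ '' U` exactly when the radical is
empty. Being a kangaroo then means that each totally isotropic line is coplanar with its image, in
particular meets it. If `U` is opposite its image, is not a point and exceeds a line, it contains a
totally isotropic line, which meets its image, although `U` and `θ '' U` are disjoint. Conversely, a
totally isotropic line `L` disjoint from its image extends by two points to a subspace with empty
radical, so something other than a line is mapped to an opposite.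

For the diagram, `M ∩ θ '' M` has codimension 0 or 2 in each maximal singular `M`
(`IsLinewiseKangaroo.dim_inter_image`). In the hyperbolic case the parity of codimensions defines
the two families (`IsHyperbolic.parity`), so `θ` preserves types and the twist must cancel the
opposition relation. As `θ ≠ 1`, some line is mapped to an opposite, which gives node 2. For `D_3`
lines are not vertices, and the two planes through such a line take its place.

The projective geometry needed is derived from the axioms: singular subspaces are the sets of
pairwise collinear points closed under double perp, and their dimension counts spanning points. -/

theorem Collinear.refl (x : P) : Γ.Collinear x x := Or.inl rfl

theorem Collinear.symm {x y : P} (h : Γ.Collinear x y) : Γ.Collinear y x := by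
  rcases h with h | ⟨L, hL, hx, hy⟩
  · exact Or.inl h.symm
  · exact Or.inr ⟨L, hL, hy, hx⟩

theorem collinear_of_mem_line {L : Set P} (hL : L ∈ Γ.lines) {x y : P} (hx : x ∈ L) (hy : y ∈ L) :
    Γ.Collinear x y := Or.inr ⟨L, hL, hx, hy⟩

theorem Collinear.exists_line {x y : P} (h : Γ.Collinear x y) (hxy : x ≠ y) :
    ∃ L ∈ Γ.lines, x ∈ L ∧ y ∈ L := h.resolve_left hxy

theorem collinear_line_of_two {L : Set P} (hL : L ∈ Γ.lines) {z x y : P} (hx : x ∈ L) (hy : y ∈ L)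
    (hxy : x ≠ y) (hzx : Γ.Collinear z x) (hzy : Γ.Collinear z y) {w : P} (hw : w ∈ L) :
    Γ.Collinear z w := by
  rcases Γ.one_or_all z L hL with h | h
  · exact h w hw
  · exact absurd (h.unique ⟨hx, hzx⟩ ⟨hy, hzy⟩) hxy

theorem nonempty_of_mem_lines {L : Set P} (hL : L ∈ Γ.lines) : L.Nonempty := by
  rw [← Set.one_le_encard_iff_nonempty]
  exact le_trans (by norm_num) (Γ.three_le_line L hL)

theorem exists_collinear_mem_line (z : P) {L : Set P} (hL : L ∈ Γ.lines) :
    ∃ w ∈ L, Γ.Collinear z w := by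
  rcases Γ.one_or_all z L hL with h | ⟨w, hw, -⟩
  · obtain ⟨x, hx⟩ : L.Nonempty := nonempty_of_mem_lines hL
    exact ⟨x, hx, h x hx⟩
  · exact ⟨w, hw⟩

theorem exists_third_mem_line {L : Set P} (hL : L ∈ Γ.lines) (x y : P) :
    ∃ z ∈ L, z ≠ x ∧ z ≠ y := by
  by_contra! h
  have h1 : L ⊆ {x, y} := fun z hz => by
    by_cases hzx : z = x
    · exact Or.inl hzx
    · exact Or.inr (h z hz hzx)
  have h2 := (Γ.three_le_line L hL).trans (Set.encard_le_encard h1)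
  have h3 := h2.trans (Set.encard_insert_le _ _)
  rw [Set.encard_singleton] at h3
  exact absurd h3 (by norm_num)

/-! ### Perps and double perps -/

variable (Γ) in
/-- The points collinear to all points of `X`. -/
def perp (X : Set P) : Set P := {z | ∀ x ∈ X, Γ.Collinear z x}

variable (Γ) in
/-- The double perp of a set of points; on sets of pairwise collinear points it is the
singular subspace they generate. -/
def cl (X : Set P) : Set P := Γ.perp (Γ.perp X)

theorem perp_anti {X Y : Set P} (h : X ⊆ Y) : Γ.perp Y ⊆ Γ.perp X := fun _ hz x hx => hz x (h hx)

theorem subset_cl (X : Set P) : X ⊆ Γ.cl X := fun x hx _ hz => (hz x hx).symm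

theorem cl_mono {X Y : Set P} (h : X ⊆ Y) : Γ.cl X ⊆ Γ.cl Y := perp_anti (perp_anti h)

theorem perp_cl (X : Set P) : Γ.perp (Γ.cl X) = Γ.perp X :=
  Set.Subset.antisymm (perp_anti (subset_cl X)) (subset_cl (Γ.perp X))

theorem perp_insert (x : P) (X : Set P) :
    Γ.perp (insert x X) = {z | Γ.Collinear z x ∧ z ∈ Γ.perp X} := by
  ext z; simp [perp]

theorem mem_perp_insert {x z : P} {X : Set P} :
    z ∈ Γ.perp (insert x X) ↔ Γ.Collinear z x ∧ z ∈ Γ.perp X := by simp [perp]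

theorem isSubspace_perp (X : Set P) : Γ.IsSubspace (Γ.perp X) :=
  fun _ hL _ hx _ hy hxy hxp hyp _ hw z hz =>
    (collinear_line_of_two hL hx hy hxy (hxp z hz).symm (hyp z hz).symm hw).symm

theorem IsSingular.subset_perp {U : Set P} (hU : Γ.IsSingular U) : U ⊆ Γ.perp U :=
  fun x hx y hy => hU.2 x hx y hy

theorem isSingular_cl {X : Set P} (hX : X ⊆ Γ.perp X) : Γ.IsSingular (Γ.cl X) := by
  refine ⟨isSubspace_perp _, fun x hx y hy => ?_⟩
  have : Γ.cl X ⊆ Γ.perp X := perp_anti hX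
  exact hx y (this hy)

theorem insert_subset_perp {U : Set P} (hU : Γ.IsSingular U) {x : P} (hx : x ∈ Γ.perp U) :
    insert x U ⊆ Γ.perp (insert x U) := by
  rintro y (rfl | hy)
  · exact mem_perp_insert.2 ⟨Collinear.refl _, hx⟩
  · exact mem_perp_insert.2 ⟨(hx y hy).symm, hU.subset_perp hy⟩

theorem IsSingular.cl_insert {U : Set P} (hU : Γ.IsSingular U) {x : P} (hx : x ∈ Γ.perp U) :
    Γ.IsSingular (Γ.cl (insert x U)) := isSingular_cl (insert_subset_perp hU hx)

theorem IsSingular.inter_perp {U : Set P} (hU : Γ.IsSingular U) (X : Set P) :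
    Γ.IsSingular (U ∩ Γ.perp X) :=
  ⟨fun L hL x hx y hy hxy hxU hyU _ hw =>
    ⟨hU.1 L hL x hx y hy hxy hxU.1 hyU.1 hw, isSubspace_perp X L hL x hx y hy hxy hxU.2 hyU.2 hw⟩,
    fun x hx y hy => hU.2 x hx.1 y hy.1⟩

theorem IsSingular.inter {U V : Set P} (hU : Γ.IsSingular U) (hV : Γ.IsSingular V) :
    Γ.IsSingular (U ∩ V) :=
  ⟨fun L hL x hx y hy hxy hxU hyU _ hw =>
    ⟨hU.1 L hL x hx y hy hxy hxU.1 hyU.1 hw, hV.1 L hL x hx y hy hxy hxU.2 hyU.2 hw⟩,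
    fun x hx y hy => hU.2 x hx.1 y hy.1⟩

theorem isSingular_empty : Γ.IsSingular (∅ : Set P) :=
  ⟨fun _ _ _ _ _ _ _ h => h.elim, fun _ h => h.elim⟩

theorem isSingular_singleton (x : P) : Γ.IsSingular ({x} : Set P) := by
  refine ⟨fun L hL y hy z hz hyz hyx hzx => ?_, ?_⟩
  · exact absurd ((Set.mem_singleton_iff.1 hyx).trans (Set.mem_singleton_iff.1 hzx).symm) hyz
  · rintro y rfl z rfl; exact Collinear.refl _

theorem isSingular_line {L : Set P} (hL : L ∈ Γ.lines) : Γ.IsSingular L := by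
  refine ⟨fun M hM x hx y hy hxy hxL hyL => ?_, fun x hx y hy => collinear_of_mem_line hL hx hy⟩
  rw [Γ.line_unique M hM L hL x y hxy hx hy hxL hyL]

theorem exists_maximal_of_singular {C : Set (Set P)} (hC : ∀ U ∈ C, Γ.IsSingular U) {U : Set P}
    (hU : U ∈ C) : ∃ M, U ⊆ M ∧ Maximal (· ∈ C) M := by
  refine zorn_subset_nonempty C (fun c hc hchain hne => ?_) U hU
  have hfin : c.Finite := Γ.finite_chains c (fun V hV => hC V (hc hV)) hchain
  obtain ⟨m, hm⟩ := hfin.exists_maximal hne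
  refine ⟨m, hc hm.1, fun s hs => ?_⟩
  rcases hchain.total hs hm.1 with h | h
  · exact h
  · exact hm.2 hs h

/-! ### Singular subspaces are closed under double perp; the exchange property -/

variable (Γ) in
/-- `U` is separated from the other points of its perp. -/
def Separated (U : Set P) : Prop := ∀ y ∈ Γ.perp U, y ∉ U → ∃ z ∈ Γ.perp U, ¬ Γ.Collinear z y

/-- The candidate is the point `v` of `L` collinear to some `z ∈ Γ.perp U` with `z` not collinear to
`x`. If `v` were outside `U`, some `q ∈ Γ.perp U` would not be collinear to `v`. Walking from `z`
towards `q` inside `Γ.perp U` gives a point `d` collinear to `x`, hence to `y` and to `v`, and this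
forces `q` to be collinear to `v`. -/
theorem Separated.exists_mem_line {U : Set P} (hs : Γ.Separated U) {x y : P} (hx : x ∈ Γ.perp U)
    (hxU : x ∉ U) (hxy : x ≠ y) (hyp : y ∈ Γ.perp U) (hy : y ∈ Γ.cl (insert x U))
    {L : Set P} (hL : L ∈ Γ.lines) (hxL : x ∈ L) (hyL : y ∈ L) : ∃ u ∈ U, u ∈ L := by
  obtain ⟨z, hz, hzx⟩ := hs x hx hxU
  obtain ⟨v, hvL, hzv⟩ := exists_collinear_mem_line z hL
  have hvp : v ∈ Γ.perp U := isSubspace_perp U L hL x hxL y hyL hxy hx hyp hvL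
  have hxv : x ≠ v := by rintro rfl; exact hzx hzv
  refine ⟨v, ?_, hvL⟩
  by_contra hvU
  obtain ⟨q, hq, hqv⟩ := hs v hvp hvU
  have hxv' : Γ.Collinear x v := collinear_of_mem_line hL hxL hvL
  obtain ⟨N, hN, hzN, hvN⟩ := hzv.exists_line (by rintro rfl; exact hzx hxv'.symm)
  obtain ⟨c, hcN, hqc⟩ := exists_collinear_mem_line q hN
  have hcv : c ≠ v := by rintro rfl; exact hqv hqc
  have hcvc : Γ.Collinear c v := collinear_of_mem_line hN hcN hvN
  have hcx : ¬ Γ.Collinear x c := fun h =>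
    hzx (collinear_line_of_two hN hcN hvN hcv h hxv' hzN).symm
  have hcp : c ∈ Γ.perp U := by
    by_cases hzv' : z = v
    · subst hzv'; exact absurd hxv'.symm hzx
    · exact isSubspace_perp U N hN z hzN v hvN hzv' hz hvp hcN
  have hqc' : q ≠ c := by rintro rfl; exact hqv hcvc
  obtain ⟨K, hK, hqK, hcK⟩ := hqc.exists_line hqc'
  obtain ⟨d, hdK, hxd⟩ := exists_collinear_mem_line x hK
  have hdp : d ∈ Γ.perp U := isSubspace_perp U K hK q hqK c hcK hqc' hq hcp hdK
  have hdc : d ≠ c := by rintro rfl; exact hcx hxd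
  have hdy : Γ.Collinear d y := (hy d (mem_perp_insert.2 ⟨hxd.symm, hdp⟩)).symm
  have hdv : Γ.Collinear d v := collinear_line_of_two hL hxL hyL hxy hxd.symm hdy hvL
  exact hqv (collinear_line_of_two hK hdK hcK hdc hdv.symm hcvc.symm hqK).symm

theorem Separated.cl_eq {U : Set P} (hU : Γ.IsSingular U) (hs : Γ.Separated U) : Γ.cl U = U := by
  refine Set.Subset.antisymm (fun y hy => ?_) (subset_cl U)
  by_contra hyU
  obtain ⟨z, hz, hzy⟩ := hs y (perp_anti hU.subset_perp hy) hyU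
  exact hzy (hy z hz).symm

/-- A double perp is separated almost by definition. The content is the inclusion: by
`Separated.exists_mem_line`, each further point of the closure lies on a line joining `x` to a point
of `W`. -/
theorem Separated.of_insert {W U : Set P} (hW : Γ.IsSingular W) (hs : Γ.Separated W)
    (hU : Γ.IsSingular U) (hWU : W ⊆ U) {x : P} (hxU : x ∈ U) (hxW : x ∉ W) :
    Γ.Separated (Γ.cl (insert x W)) ∧ Γ.cl (insert x W) ⊆ U := by
  have hx : x ∈ Γ.perp W := perp_anti hWU (hU.subset_perp hxU)
  have key : ∀ y ∈ Γ.perp W, y ∈ Γ.cl (insert x W) → y ∈ U := by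
    intro y hyp hy
    by_cases hxy : x = y
    · exact hxy ▸ hxU
    have hcol : Γ.Collinear x y :=
      (hy x ((insert_subset_perp hW hx) (Set.mem_insert _ _))).symm
    obtain ⟨L, hL, hxL, hyL⟩ := hcol.exists_line hxy
    obtain ⟨u, hu, huL⟩ := hs.exists_mem_line hx hxW hxy hyp hy hL hxL hyL
    exact hU.1 L hL x hxL u huL (by rintro rfl; exact hxW hu) hxU (hWU hu) hyL
  have hsub : Γ.cl (insert x W) ⊆ Γ.perp W := fun y hy =>
    perp_anti ((Set.subset_insert x W).trans (insert_subset_perp hW hx)) hy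
  refine ⟨?_, fun y hy => key y (hsub hy) hy⟩
  intro y hy hyn
  rw [perp_cl] at hy ⊢
  by_contra! h
  exact hyn fun z hz => (h z hz).symm

/-- Nondegeneracy makes `∅` separated, and a maximal separated singular subspace inside `U` can be
enlarged by `Separated.of_insert` unless it is `U`. -/
theorem isSingular_separated {U : Set P} (hU : Γ.IsSingular U) : Γ.Separated U := by
  let C : Set (Set P) := {W | Γ.IsSingular W ∧ Γ.Separated W ∧ W ⊆ U}
  have h0 : (∅ : Set P) ∈ C := by
    refine ⟨isSingular_empty, fun y _ _ => ?_, Set.empty_subset _⟩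
    obtain ⟨q, hq⟩ := Γ.nondegenerate y
    exact ⟨q, fun x hx => hx.elim, fun h => hq h.symm⟩
  obtain ⟨M, -, hM⟩ := exists_maximal_of_singular (Γ := Γ) (C := C) (fun V hV => hV.1) h0
  obtain ⟨⟨hMs, hMsep, hMU⟩, hmax⟩ := hM
  by_cases h : U ⊆ M
  · rwa [Set.Subset.antisymm h hMU]
  · obtain ⟨x, hxU, hxM⟩ := Set.not_subset.1 h
    obtain ⟨h1, h2⟩ := hMsep.of_insert hMs hU hMU hxU hxM
    have hx : x ∈ Γ.perp M := perp_anti hMU (hU.subset_perp hxU)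
    have h3 : Γ.cl (insert x M) ∈ C := ⟨hMs.cl_insert hx, h1, h2⟩
    have h4 := hmax h3 ((Set.subset_insert _ _).trans (subset_cl _))
    exact absurd (h4 (subset_cl _ (Set.mem_insert _ _))) hxM

theorem IsSingular.cl_eq {U : Set P} (hU : Γ.IsSingular U) : Γ.cl U = U :=
  (isSingular_separated hU).cl_eq hU

theorem IsSingular.exists_not_collinear {U : Set P} (hU : Γ.IsSingular U) {y : P} (hyU : y ∉ U) :
    ∃ z ∈ Γ.perp U, ¬ Γ.Collinear z y := by
  by_contra! h
  exact hyU (hU.cl_eq ▸ fun z hz => (h z hz).symm)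

theorem IsSingular.cl_subset {U X : Set P} (hU : Γ.IsSingular U) (h : X ⊆ U) : Γ.cl X ⊆ U :=
  (cl_mono h).trans hU.cl_eq.subset

theorem IsSingular.exists_mem_line {U : Set P} (hU : Γ.IsSingular U) {x y : P} (hx : x ∈ Γ.perp U)
    (hxU : x ∉ U) (hxy : x ≠ y) (hy : y ∈ Γ.cl (insert x U)) :
    ∃ L ∈ Γ.lines, x ∈ L ∧ y ∈ L ∧ ∃ u ∈ U, u ∈ L := by
  have hyp : y ∈ Γ.perp U :=
    perp_anti ((Set.subset_insert x U).trans (insert_subset_perp hU hx)) hy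
  have hcol : Γ.Collinear x y :=
    (hy x ((insert_subset_perp hU hx) (Set.mem_insert _ _))).symm
  obtain ⟨L, hL, hxL, hyL⟩ := hcol.exists_line hxy
  exact ⟨L, hL, hxL, hyL,
    (isSingular_separated hU).exists_mem_line hx hxU hxy hyp hy hL hxL hyL⟩

/-- Exchange property of singular subspaces. -/
theorem IsSingular.cl_insert_eq {U : Set P} (hU : Γ.IsSingular U) {x y : P} (hx : x ∈ Γ.perp U)
    (hxU : x ∉ U) (hyU : y ∉ U) (hy : y ∈ Γ.cl (insert x U)) :
    Γ.cl (insert y U) = Γ.cl (insert x U) := by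
  have hU' := hU.cl_insert hx
  have hyp : y ∈ Γ.perp U :=
    perp_anti ((Set.subset_insert x U).trans (insert_subset_perp hU hx)) hy
  refine Set.Subset.antisymm (hU'.cl_subset
    (Set.insert_subset hy ((Set.subset_insert _ _).trans (subset_cl _)))) ?_
  have hU'' := hU.cl_insert hyp
  refine hU''.cl_subset (Set.insert_subset ?_ ((Set.subset_insert _ _).trans (subset_cl _)))
  by_cases hxy : x = y
  · subst hxy; exact subset_cl _ (Set.mem_insert _ _)
  obtain ⟨L, hL, hxL, hyL, u, hu, huL⟩ := hU.exists_mem_line hx hxU hxy hy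
  exact hU''.1 L hL y hyL u huL (by rintro rfl; exact hyU hu) (subset_cl _ (Set.mem_insert _ _))
    (subset_cl _ (Set.mem_insert_of_mem _ hu)) hxL

/-- In a singular subspace, a subspace spanned by `U` and one more point has `U` as a hyperplane. -/
theorem IsSingular.line_meets {U : Set P} (hU : Γ.IsSingular U) {x : P} (hx : x ∈ Γ.perp U)
    (hxU : x ∉ U) {L : Set P} (hL : L ∈ Γ.lines) {y z : P} (hyz : y ≠ z) (hyL : y ∈ L)
    (hzL : z ∈ L) (hy : y ∈ Γ.cl (insert x U)) (hz : z ∈ Γ.cl (insert x U)) :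
    ∃ u ∈ U, u ∈ L := by
  by_cases hyU : y ∈ U
  · exact ⟨y, hyU, hyL⟩
  have hyp : y ∈ Γ.perp U :=
    perp_anti ((Set.subset_insert x U).trans (insert_subset_perp hU hx)) hy
  rw [← hU.cl_insert_eq hx hxU hyU hy] at hz
  obtain ⟨K, hK, hyK, hzK, u, hu, huK⟩ := hU.exists_mem_line hyp hyU hyz hz
  rw [Γ.line_unique L hL K hK y z hyz hyL hzL hyK hzK]
  exact ⟨u, hu, huK⟩

theorem IsSingular.subset_of_hyperplane {U V : Set P} (hU : Γ.IsSingular U) (hV : Γ.IsSingular V)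
    {x y : P} (hx : x ∈ Γ.perp U) (hxU : x ∉ U) (hVU : V ⊆ Γ.cl (insert x U)) (hyV : y ∈ V)
    (hyU : y ∉ U) : Γ.cl (insert y (V ∩ U)) = V := by
  refine Set.Subset.antisymm (hV.cl_subset (Set.insert_subset hyV Set.inter_subset_left)) ?_
  intro z hz
  by_cases hyz : y = z
  · subst hyz; exact subset_cl _ (Set.mem_insert _ _)
  obtain ⟨L, hL, hyL, hzL⟩ := (hV.2 y hyV z hz).exists_line hyz
  obtain ⟨u, hu, huL⟩ := hU.line_meets hx hxU hL hyz hyL hzL (hVU hyV) (hVU hz)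
  have hyu : y ≠ u := by rintro rfl; exact hyU hu
  have huV : u ∈ V := hV.1 L hL y hyL z hzL hyz hyV hz huL
  have hs := (hV.inter hU).cl_insert (x := y) (fun w hw => hV.2 y hyV w hw.1)
  exact hs.1 L hL y hyL u huL hyu (subset_cl _ (Set.mem_insert _ _))
    (subset_cl _ (Set.mem_insert_of_mem _ ⟨huV, hu⟩)) hzL

/-- The points of a singular subspace collinear to a given point form a hyperplane. -/
theorem IsSingular.cl_insert_inter_perp {V : Set P} (hV : Γ.IsSingular V) (p : P) {y : P}
    (hy : y ∈ V) (hyp : ¬ Γ.Collinear y p) : Γ.cl (insert y (V ∩ Γ.perp {p})) = V := by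
  refine Set.Subset.antisymm (hV.cl_subset (Set.insert_subset hy Set.inter_subset_left)) ?_
  intro z hz
  by_cases hyz : y = z
  · subst hyz; exact subset_cl _ (Set.mem_insert _ _)
  obtain ⟨L, hL, hyL, hzL⟩ := (hV.2 y hy z hz).exists_line hyz
  obtain ⟨u, huL, hpu⟩ := exists_collinear_mem_line p hL
  have hyu : y ≠ u := by rintro rfl; exact hyp hpu.symm
  have huV : u ∈ V := hV.1 L hL y hyL z hzL hyz hy hz huL
  have hs := (hV.inter_perp {p}).cl_insert (x := y) (fun w hw => hV.2 y hy w hw.1)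
  refine hs.1 L hL y hyL u huL hyu (subset_cl _ (Set.mem_insert _ _))
    (subset_cl _ (Set.mem_insert_of_mem _ ⟨huV, ?_⟩)) hzL
  rintro w rfl
  exact hpu.symm

/-- Singular subspaces containing `V` are reached from `V` by adding one point at a time. -/
theorem IsSingular.induction_insert {U V : Set P} (hU : Γ.IsSingular U) (hV : Γ.IsSingular V)
    (hVU : V ⊆ U) {Q : Set P → Prop} (base : Q V)
    (step : ∀ W x, Γ.IsSingular W → V ⊆ W → W ⊆ U → x ∈ U → x ∉ W → Q W →
      Q (Γ.cl (insert x W))) : Q U := by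
  obtain ⟨M, hVM, ⟨hMs, hVM', hMU, hQ⟩, hmax⟩ :=
    exists_maximal_of_singular (Γ := Γ) (C := {W | Γ.IsSingular W ∧ V ⊆ W ∧ W ⊆ U ∧ Q W})
      (fun V hV => hV.1) (U := V) ⟨hV, subset_rfl, hVU, base⟩
  by_cases h : U ⊆ M
  · rwa [Set.Subset.antisymm h hMU]
  · obtain ⟨x, hxU, hxM⟩ := Set.not_subset.1 h
    have hx : x ∈ Γ.perp M := perp_anti hMU (hU.subset_perp hxU)
    have hsub : M ⊆ Γ.cl (insert x M) := (Set.subset_insert _ _).trans (subset_cl _)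
    have h4 := hmax (y := Γ.cl (insert x M)) ⟨hMs.cl_insert hx, hVM.trans hsub,
      hU.cl_subset (Set.insert_subset hxU hMU), step M x hMs hVM hMU hxU hxM hQ⟩ hsub
    exact absurd (h4 (subset_cl _ (Set.mem_insert _ _))) hxM

theorem IsSingular.exists_isMaximalSingular {U : Set P} (hU : Γ.IsSingular U) :
    ∃ M, U ⊆ M ∧ Γ.IsMaximalSingular M :=
  exists_maximal_of_singular (Γ := Γ) (C := {V | Γ.IsSingular V}) (fun _ h => h) hU

theorem IsMaximalSingular.mem_of_mem_perp {M : Set P} (hM : Γ.IsMaximalSingular M) {x : P}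
    (hx : x ∈ Γ.perp M) : x ∈ M :=
  hM.2 (hM.1.cl_insert hx) ((Set.subset_insert _ _).trans (subset_cl _))
    (subset_cl _ (Set.mem_insert _ _))

/-! ### Dimension of singular subspaces -/

variable (Γ) in
/-- The singular subspace `U` is reached from `∅` by adding `k` points, one at a time. -/
inductive HasDim : Set P → ℕ → Prop
  | empty : HasDim ∅ 0
  | insert {U : Set P} {k : ℕ} {x : P} : HasDim U k → x ∈ Γ.perp U → x ∉ U →
      HasDim (Γ.cl (insert x U)) (k + 1)

theorem HasDim.isSingular {U : Set P} {k : ℕ} (h : Γ.HasDim U k) : Γ.IsSingular U := by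
  induction h with
  | empty => exact isSingular_empty
  | insert _ hx _ ih => exact ih.cl_insert hx

theorem HasDim.eq_empty {U : Set P} (h : Γ.HasDim U 0) : U = ∅ := by
  cases h; rfl

theorem HasDim.exists_hyperplane {U : Set P} {k : ℕ} (h : Γ.HasDim U (k + 1)) :
    ∃ W x, Γ.HasDim W k ∧ x ∈ Γ.perp W ∧ x ∉ W ∧ U = Γ.cl (Insert.insert x W) := by
  cases h with
  | insert h1 h2 h3 => exact ⟨_, _, h1, h2, h3, rfl⟩

theorem mem_cl_insert (x : P) (U : Set P) : x ∈ Γ.cl (insert x U) :=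
  subset_cl _ (Set.mem_insert _ _)

theorem subset_cl_insert (x : P) (U : Set P) : U ⊆ Γ.cl (insert x U) :=
  (Set.subset_insert _ _).trans (subset_cl _)

theorem IsSingular.exists_hasDim {U : Set P} (hU : Γ.IsSingular U) : ∃ k, Γ.HasDim U k := by
  refine hU.induction_insert isSingular_empty (Set.empty_subset _) (Q := fun V => ∃ k, Γ.HasDim V k)
    ⟨0, .empty⟩ ?_
  rintro W x hW - hWU hxU hxW ⟨k, hk⟩
  exact ⟨k + 1, .insert hk (perp_anti hWU (hU.subset_perp hxU)) hxW⟩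

theorem HasDim.of_subset {U : Set P} {k : ℕ} (h : Γ.HasDim U k) :
    ∀ V, Γ.IsSingular V → V ⊆ U → ∃ j ≤ k, Γ.HasDim V j := by
  induction h with
  | empty =>
    intro V _ hV
    rw [Set.subset_empty_iff.1 hV]
    exact ⟨0, le_rfl, .empty⟩
  | @insert U k x hU hx hxU ih =>
    intro V hV hVU
    by_cases h : V ⊆ U
    · obtain ⟨j, hj, hj'⟩ := ih V hV h
      exact ⟨j, by omega, hj'⟩
    · obtain ⟨y, hyV, hyU⟩ := Set.not_subset.1 h
      have hUs := hU.isSingular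
      obtain ⟨j, hj, hj'⟩ := ih (V ∩ U) (hV.inter hUs) Set.inter_subset_right
      refine ⟨j + 1, by omega, ?_⟩
      rw [← hUs.subset_of_hyperplane hV hx hxU hVU hyV hyU]
      exact .insert hj' (fun w hw => hV.2 y hyV w hw.1) (fun h => hyU h.2)

/-- A Jordan–Hölder argument: two distinct hyperplanes `W` and `W'` of the same subspace have `W ∩
W'` as a common hyperplane, so the induction hypothesis compares them through it. -/
theorem HasDim.unique {U : Set P} {k j : ℕ} (h : Γ.HasDim U k) (h' : Γ.HasDim U j) : j = k := by
  induction k generalizing U j with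
  | zero =>
    cases j with
    | zero => rfl
    | succ j =>
      obtain ⟨W, x, -, -, -, hW⟩ := h'.exists_hyperplane
      have := mem_cl_insert (Γ := Γ) x W
      rw [← hW, h.eq_empty] at this
      exact this.elim
  | succ k ih =>
    cases j with
    | zero =>
      obtain ⟨W, x, -, -, -, hW⟩ := h.exists_hyperplane
      have := mem_cl_insert (Γ := Γ) x W
      rw [← hW, h'.eq_empty] at this
      exact this.elim
    | succ j =>
      obtain ⟨W, x, hW, hx, hxW, rfl⟩ := h.exists_hyperplane
      obtain ⟨W', x', hW', hx', hxW', heq⟩ := h'.exists_hyperplane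
      have hWs := hW.isSingular
      have hWs' := hW'.isSingular
      by_cases h1 : W' ⊆ W
      · have h2 : W ⊆ W' := by
          by_contra h2
          obtain ⟨y, hy, hyW'⟩ := Set.not_subset.1 h2
          have hyc : y ∈ Γ.cl (Insert.insert x' W') := heq ▸ subset_cl_insert x W hy
          have h3 := hWs'.cl_insert_eq hx' hxW' hyW' hyc
          have h4 : Γ.cl (Insert.insert y W') ⊆ W := hWs.cl_subset (Set.insert_subset hy h1)
          rw [h3, ← heq] at h4
          exact hxW (h4 (mem_cl_insert x W))
        have h3 : W = W' := Set.Subset.antisymm h2 h1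
        subst h3
        rw [ih hW hW']
      · obtain ⟨y, hyW', hyW⟩ := Set.not_subset.1 h1
        have hsub : W' ⊆ Γ.cl (Insert.insert x W) := heq ▸ subset_cl_insert x' W'
        have e1 := hWs.subset_of_hyperplane hWs' hx hxW hsub hyW' hyW
        have h2 : ¬ W ⊆ W' := by
          intro h2
          have h3 := hWs.cl_insert_eq hx hxW hyW (hsub hyW')
          have h4 : Γ.cl (Insert.insert y W) ⊆ W' := hWs'.cl_subset (Set.insert_subset hyW' h2)
          rw [h3, heq] at h4
          exact hxW' (h4 (mem_cl_insert x' W'))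
        obtain ⟨z, hzW, hzW'⟩ := Set.not_subset.1 h2
        have hsub' : W ⊆ Γ.cl (Insert.insert x' W') := heq ▸ subset_cl_insert x W
        have e2 := hWs'.subset_of_hyperplane hWs hx' hxW' hsub' hzW hzW'
        obtain ⟨i, -, hi⟩ := hW.of_subset (W ∩ W') (hWs.inter hWs') Set.inter_subset_left
        have d2 : Γ.HasDim W (i + 1) :=
          e2 ▸ hi.insert (fun w hw => hWs.2 z hzW w hw.1) (fun h => hzW' h.2)
        have d1 : Γ.HasDim W' (i + 1) := by
          rw [Set.inter_comm] at hi
          exact e1 ▸ hi.insert (fun w hw => hWs'.2 y hyW' w hw.1) (fun h => hyW h.2)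
        have hk : i + 1 = k := ih hW d2
        rw [hk] at d1
        rw [ih d1 hW']

variable (Γ) in
/-- The dimension, as a vector space, of a singular subspace. -/
noncomputable def dim (U : Set P) : ℕ := sInf {k | Γ.HasDim U k}

theorem IsSingular.hasDim {U : Set P} (hU : Γ.IsSingular U) : Γ.HasDim U (Γ.dim U) :=
  Nat.sInf_mem (s := {k | Γ.HasDim U k}) hU.exists_hasDim

theorem HasDim.dim_eq {U : Set P} {k : ℕ} (h : Γ.HasDim U k) : Γ.dim U = k :=
  h.unique h.isSingular.hasDim

theorem dim_empty : Γ.dim (∅ : Set P) = 0 := HasDim.empty.dim_eq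

theorem IsSingular.dim_cl_insert {U : Set P} (hU : Γ.IsSingular U) {x : P} (hx : x ∈ Γ.perp U)
    (hxU : x ∉ U) : Γ.dim (Γ.cl (insert x U)) = Γ.dim U + 1 :=
  (hU.hasDim.insert hx hxU).dim_eq

theorem IsSingular.dim_le {U V : Set P} (hU : Γ.IsSingular U) (hV : Γ.IsSingular V) (h : V ⊆ U) :
    Γ.dim V ≤ Γ.dim U := by
  obtain ⟨j, hj, hd⟩ := hU.hasDim.of_subset V hV h
  rwa [hd.dim_eq]

theorem IsSingular.dim_lt {U V : Set P} (hU : Γ.IsSingular U) (hV : Γ.IsSingular V) (h : V ⊆ U)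
    {x : P} (hxU : x ∈ U) (hxV : x ∉ V) : Γ.dim V < Γ.dim U := by
  have hx : x ∈ Γ.perp V := perp_anti h (hU.subset_perp hxU)
  have := hU.dim_le (hV.cl_insert hx) (hU.cl_subset (Set.insert_subset hxU h))
  rw [hV.dim_cl_insert hx hxV] at this
  omega

theorem IsSingular.eq_of_dim_le {U V : Set P} (hU : Γ.IsSingular U) (hV : Γ.IsSingular V)
    (h : V ⊆ U) (hd : Γ.dim U ≤ Γ.dim V) : V = U := by
  refine Set.Subset.antisymm h fun x hx => ?_
  by_contra hxV
  exact absurd (hU.dim_lt hV h hx hxV) (by omega)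

theorem IsSingular.dim_pos {U : Set P} (hU : Γ.IsSingular U) (h : U.Nonempty) : 0 < Γ.dim U := by
  obtain ⟨x, hx⟩ := h
  have := hU.dim_lt isSingular_empty (Set.empty_subset _) hx (Set.notMem_empty x)
  omega

theorem HasDim.exists_chain {U : Set P} {k : ℕ} (h : Γ.HasDim U k) :
    ∃ t ⊆ {V : Set P | Γ.IsSingular V ∧ V.Nonempty ∧ V ⊆ U}, IsChain (· ⊆ ·) t ∧ t.encard = k := by
  induction h with
  | empty => exact ⟨∅, by simp, by simp, by simp⟩
  | @insert U k x hU hx hxU ih =>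
    obtain ⟨t, ht, hc, hcard⟩ := ih
    have hsub := subset_cl_insert (Γ := Γ) x U
    refine ⟨Insert.insert (Γ.cl (Insert.insert x U)) t, ?_, ?_, ?_⟩
    · rintro V (rfl | hV)
      · exact ⟨hU.isSingular.cl_insert hx, ⟨x, mem_cl_insert x U⟩, subset_rfl⟩
      · exact ⟨(ht hV).1, (ht hV).2.1, (ht hV).2.2.trans hsub⟩
    · exact hc.insert fun V hV _ => Or.inr ((ht hV).2.2.trans hsub)
    · rw [Set.encard_insert_of_notMem, hcard]
      · norm_cast
      · intro hmem
        exact hxU ((ht hmem).2.2 (mem_cl_insert x U))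

/-- On a chain of nonempty singular subspaces `dim` is injective with values in `[1, dim U]`. Adding
spanning points one at a time gives a chain attaining the bound. -/
theorem IsSingular.rk_eq {U : Set P} (hU : Γ.IsSingular U) : Γ.rk U = Γ.dim U := by
  apply le_antisymm
  · refine iSup_le ?_
    rintro ⟨t, ht, hc⟩
    have hmaps : Set.MapsTo Γ.dim t (Set.Icc 1 (Γ.dim U)) := fun V hV =>
      ⟨(ht hV).1.dim_pos (ht hV).2.1, hU.dim_le (ht hV).1 (ht hV).2.2⟩
    have hinj : Set.InjOn Γ.dim t := by
      intro V hV W hW h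
      rcases hc.total hV hW with h1 | h1
      · exact (ht hW).1.eq_of_dim_le (ht hV).1 h1 h.ge
      · exact ((ht hV).1.eq_of_dim_le (ht hW).1 h1 h.le).symm
    have h1 := Set.encard_le_encard_of_injOn hmaps hinj
    refine h1.trans ?_
    rw [← Finset.coe_Icc, Set.encard_coe_eq_coe_finsetCard]
    simp
  · obtain ⟨t, ht, hc, hcard⟩ := hU.hasDim.exists_chain
    rw [← hcard]
    exact Set.encard_le_chainHeight_of_isChain _ _ ht hc

theorem dim_singleton (x : P) : Γ.dim ({x} : Set P) = 1 := by
  have h := isSingular_empty (Γ := Γ).dim_cl_insert (x := x) (fun _ h => h.elim)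
    (Set.notMem_empty x)
  rw [insert_empty_eq, (isSingular_singleton x).cl_eq, dim_empty] at h
  exact h

theorem cl_pair {L : Set P} (hL : L ∈ Γ.lines) {x y : P} (hxy : x ≠ y) (hx : x ∈ L) (hy : y ∈ L) :
    Γ.cl {x, y} = L := by
  refine Set.Subset.antisymm ((isSingular_line hL).cl_subset
    (Set.insert_subset hx (Set.singleton_subset_iff.2 hy))) ?_
  have hs : Γ.IsSingular (Γ.cl {x, y}) := (isSingular_singleton y).cl_insert
    (by rintro z rfl; exact collinear_of_mem_line hL hx hy)
  exact hs.1 L hL x hx y hy hxy (subset_cl _ (by simp)) (subset_cl _ (by simp))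

theorem dim_line {L : Set P} (hL : L ∈ Γ.lines) : Γ.dim L = 2 := by
  obtain ⟨x, hx⟩ := nonempty_of_mem_lines hL
  obtain ⟨y, hy, hyx, -⟩ := exists_third_mem_line hL x x
  rw [← cl_pair hL hyx hy hx, (isSingular_singleton x).dim_cl_insert (x := y) _ (by simpa),
    dim_singleton]
  rintro z rfl; exact collinear_of_mem_line hL hy hx

theorem IsSingular.exists_line_of_mem {U : Set P} (hU : Γ.IsSingular U) (h : 2 ≤ Γ.dim U) {x : P}
    (hx : x ∈ U) : ∃ L ∈ Γ.lines, x ∈ L ∧ L ⊆ U := by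
  have : ¬ U ⊆ {x} := fun hsub => by
    have := (isSingular_singleton x).dim_le hU hsub
    rw [dim_singleton] at this
    omega
  obtain ⟨y, hy, hyx⟩ := Set.not_subset.1 this
  have hne : x ≠ y := fun h => hyx h.symm
  obtain ⟨L, hL, hxL, hyL⟩ := (hU.2 x hx y hy).exists_line hne
  exact ⟨L, hL, hxL, hU.1 L hL x hxL y hyL hne hx hy⟩

theorem perp_cl_insert (x : P) (W : Set P) :
    Γ.perp (Γ.cl (insert x W)) = Γ.perp W ∩ Γ.perp {x} := by
  rw [perp_cl, perp_insert]
  ext z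
  simp [perp, and_comm]

theorem IsSingular.dim_le_inter_perp_singleton {V : Set P} (hV : Γ.IsSingular V) (p : P) :
    Γ.dim V ≤ Γ.dim (V ∩ Γ.perp {p}) + 1 := by
  by_cases h : ∀ y ∈ V, Γ.Collinear y p
  · have : V ∩ Γ.perp {p} = V := Set.inter_eq_left.2 fun y hy z hz => by
      rw [Set.mem_singleton_iff.1 hz]; exact h y hy
    rw [this]; omega
  · push Not at h
    obtain ⟨y, hy, hyp⟩ := h
    have hd := (hV.inter_perp {p}).dim_cl_insert (x := y) (fun w hw => hV.2 y hy w hw.1)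
      (fun h => hyp (h.2 p rfl))
    rw [hV.cl_insert_inter_perp p hy hyp] at hd
    exact hd.le

/-- Each point added to `W` on the way to `U` imposes one more condition on `M`, which lowers the
dimension by at most one. -/
theorem IsSingular.dim_inter_perp {M U W : Set P} (hM : Γ.IsSingular M) (hU : Γ.IsSingular U)
    (hW : Γ.IsSingular W) (hWU : W ⊆ U) :
    Γ.dim (M ∩ Γ.perp W) + Γ.dim W ≤ Γ.dim (M ∩ Γ.perp U) + Γ.dim U := by
  refine hU.induction_insert hW hWU
    (Q := fun V => Γ.dim (M ∩ Γ.perp W) + Γ.dim W ≤ Γ.dim (M ∩ Γ.perp V) + Γ.dim V) le_rfl ?_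
  intro V x hV _ hVU hxU hxV ih
  have hx : x ∈ Γ.perp V := perp_anti hVU (hU.subset_perp hxU)
  rw [hV.dim_cl_insert hx hxV, perp_cl_insert, ← Set.inter_assoc]
  have := (hM.inter_perp V).dim_le_inter_perp_singleton x
  omega

theorem perp_empty : Γ.perp (∅ : Set P) = Set.univ := by
  ext; simp [perp]

/-! ### Opposite subspaces and coplanar lines -/

theorem Opposite.symm {U V : Set P} (h : Γ.Opposite U V) : Γ.Opposite V U :=
  ⟨fun x hx => (h.2 x hx).imp fun _ h => ⟨h.1, fun h' => h.2 h'.symm⟩,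
    fun x hx => (h.1 x hx).imp fun _ h => ⟨h.1, fun h' => h.2 h'.symm⟩⟩

theorem Opposite.inter_perp {U V : Set P} (h : Γ.Opposite U V) : U ∩ Γ.perp V = ∅ := by
  rw [Set.eq_empty_iff_forall_notMem]
  rintro x ⟨hx, hxV⟩
  obtain ⟨y, hy, hxy⟩ := h.1 x hx
  exact hxy (hxV y hy)

theorem Opposite.disjoint {U V : Set P} (h : Γ.Opposite U V) (hV : Γ.IsSingular V) {x : P}
    (hxU : x ∈ U) (hxV : x ∈ V) : False := by
  have : x ∈ U ∩ Γ.perp V := ⟨hxU, hV.subset_perp hxV⟩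
  rw [h.inter_perp] at this
  exact this

theorem Opposite.dim_le {U V : Set P} (hU : Γ.IsSingular U) (hV : Γ.IsSingular V)
    (h : Γ.Opposite U V) : Γ.dim U ≤ Γ.dim V := by
  have := hU.dim_inter_perp hV isSingular_empty (Set.empty_subset _)
  rw [perp_empty, Set.inter_univ, h.inter_perp, dim_empty] at this
  omega

theorem Opposite.dim_eq {U V : Set P} (hU : Γ.IsSingular U) (hV : Γ.IsSingular V)
    (h : Γ.Opposite U V) : Γ.dim U = Γ.dim V :=
  le_antisymm (h.dim_le hU hV) (h.symm.dim_le hV hU)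

/-- Two lines in a singular plane meet. -/
theorem Coplanar.exists_mem_inter {L M : Set P} (hL : L ∈ Γ.lines) (hM : M ∈ Γ.lines)
    (h : Γ.Coplanar L M) : ∃ x, x ∈ L ∧ x ∈ M := by
  obtain ⟨U, hU, hrk, hLU, hMU⟩ := h
  rw [hU.rk_eq] at hrk
  have hd : Γ.dim U = 3 := by exact_mod_cast hrk
  have hLs := isSingular_line hL
  have hMs := isSingular_line hM
  by_cases hML : M ⊆ L
  · obtain ⟨x, hx⟩ := nonempty_of_mem_lines hM
    exact ⟨x, hML hx, hx⟩
  · obtain ⟨y, hyM, hyL⟩ := Set.not_subset.1 hML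
    have hyp : y ∈ Γ.perp L := perp_anti hLU (hU.subset_perp (hMU hyM))
    have hUe : Γ.cl (insert y L) = U := hU.eq_of_dim_le (hLs.cl_insert hyp)
      (hU.cl_subset (Set.insert_subset (hMU hyM) hLU))
      (by rw [hLs.dim_cl_insert hyp hyL, dim_line hL, hd])
    obtain ⟨z, hzM, hzy, -⟩ := exists_third_mem_line hM y y
    obtain ⟨u, hu, huM⟩ := hLs.line_meets hyp hyL hM hzy.symm hyM hzM
      (mem_cl_insert y L) (hUe ▸ hMU hzM)
    exact ⟨u, hu, huM⟩

theorem Coplanar.collinear {L M : Set P} (h : Γ.Coplanar L M) {x y : P} (hx : x ∈ L) (hy : y ∈ M) :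
    Γ.Collinear x y := by
  obtain ⟨U, hU, -, hLU, hMU⟩ := h
  exact hU.2 x (hLU hx) y (hMU hy)

/-! ### Collineations -/

variable {θ : Equiv.Perm P} {n : ℕ}

theorem IsCollineation.image_line (hθ : Γ.IsCollineation θ) {L : Set P} (hL : L ∈ Γ.lines) :
    θ '' L ∈ Γ.lines := (hθ L).2 hL

theorem IsCollineation.symm (hθ : Γ.IsCollineation θ) : Γ.IsCollineation θ.symm := fun L => by
  rw [← hθ, ← Set.image_comp, Equiv.self_comp_symm, Set.image_id]

theorem IsCollineation.map_collinear (hθ : Γ.IsCollineation θ) {x y : P} (h : Γ.Collinear x y) :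
    Γ.Collinear (θ x) (θ y) := by
  rcases h with rfl | ⟨L, hL, hx, hy⟩
  · exact Collinear.refl _
  · exact Or.inr ⟨_, hθ.image_line hL, Set.mem_image_of_mem _ hx, Set.mem_image_of_mem _ hy⟩

theorem IsCollineation.collinear_iff (hθ : Γ.IsCollineation θ) {x y : P} :
    Γ.Collinear (θ x) (θ y) ↔ Γ.Collinear x y :=
  ⟨fun h => by simpa using hθ.symm.map_collinear h, hθ.map_collinear⟩

theorem IsCollineation.image_perp (hθ : Γ.IsCollineation θ) (X : Set P) :
    θ '' Γ.perp X = Γ.perp (θ '' X) := by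
  ext z
  obtain ⟨w, rfl⟩ := θ.surjective z
  rw [θ.injective.mem_set_image]
  refine ⟨fun h => ?_, fun h x hx => hθ.collinear_iff.1 (h _ (Set.mem_image_of_mem _ hx))⟩
  rintro _ ⟨x, hx, rfl⟩
  exact hθ.map_collinear (h x hx)

theorem IsCollineation.image_cl (hθ : Γ.IsCollineation θ) (X : Set P) :
    θ '' Γ.cl X = Γ.cl (θ '' X) := by
  rw [cl, hθ.image_perp, hθ.image_perp, cl]

theorem HasDim.image (hθ : Γ.IsCollineation θ) {U : Set P} {k : ℕ} (h : Γ.HasDim U k) :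
    Γ.HasDim (θ '' U) k := by
  induction h with
  | empty => rw [Set.image_empty]; exact .empty
  | @insert U k x hU hx hxU ih =>
    rw [hθ.image_cl, Set.image_insert_eq]
    exact ih.insert (hθ.image_perp U ▸ Set.mem_image_of_mem θ hx)
      (fun h => hxU ((θ.injective.mem_set_image).1 h))

theorem IsSingular.image {U : Set P} (hU : Γ.IsSingular U) (hθ : Γ.IsCollineation θ) :
    Γ.IsSingular (θ '' U) := (hU.hasDim.image hθ).isSingular

theorem IsSingular.dim_image {U : Set P} (hU : Γ.IsSingular U) (hθ : Γ.IsCollineation θ) :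
    Γ.dim (θ '' U) = Γ.dim U := (hU.hasDim.image hθ).dim_eq

/-! ### Rank -/

theorem HasRank.dim_eq (h : Γ.HasRank n) {M : Set P} (hM : Γ.IsMaximalSingular M) :
    Γ.dim M = n := by
  have := h M hM
  rw [hM.1.rk_eq] at this
  exact_mod_cast this

theorem HasRank.exists_mem_perp (h : Γ.HasRank n) {U : Set P} (hU : Γ.IsSingular U)
    (hd : Γ.dim U < n) : ∃ r ∈ Γ.perp U, r ∉ U := by
  obtain ⟨M, hUM, hM⟩ := hU.exists_isMaximalSingular
  have : ¬ M ⊆ U := fun h' => by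
    have := hU.dim_le hM.1 h'
    rw [h.dim_eq hM] at this
    omega
  obtain ⟨r, hr, hrU⟩ := Set.not_subset.1 this
  exact ⟨r, perp_anti hUM (hM.1.subset_perp hr), hrU⟩

theorem HasRank.dim_le (h : Γ.HasRank n) {U : Set P} (hU : Γ.IsSingular U) : Γ.dim U ≤ n := by
  obtain ⟨M, hUM, hM⟩ := hU.exists_isMaximalSingular
  rw [← h.dim_eq hM]
  exact hM.1.dim_le hU hUM

theorem HasRank.isMaximalSingular (h : Γ.HasRank n) {U : Set P} (hU : Γ.IsSingular U)
    (hd : n ≤ Γ.dim U) : Γ.IsMaximalSingular U := by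
  obtain ⟨M, hUM, hM⟩ := hU.exists_isMaximalSingular
  rwa [hM.1.eq_of_dim_le hU hUM (by rwa [h.dim_eq hM])]

theorem HasRank.exists_line (h : Γ.HasRank n) (hn : 3 ≤ n) (p : P) : ∃ L ∈ Γ.lines, p ∈ L := by
  obtain ⟨M, hUM, hM⟩ := (isSingular_singleton (Γ := Γ) p).exists_isMaximalSingular
  obtain ⟨L, hL, hpL, -⟩ := hM.1.exists_line_of_mem (by rw [h.dim_eq hM]; omega) (hUM rfl)
  exact ⟨L, hL, hpL⟩

/-! ### Anisotropic collineations -/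

theorem opposite_image_of_forall_not_collinear (h : ∀ x, ¬ Γ.Collinear x (θ x)) (U : Set P) :
    Γ.Opposite U (θ '' U) := by
  refine ⟨fun x hx => ⟨θ x, Set.mem_image_of_mem _ hx, h x⟩, ?_⟩
  rintro _ ⟨x, hx, rfl⟩
  exact ⟨x, hx, h x⟩

theorem exists_isChamber {S : Set (Set P)} (hS : Γ.IsSimplex n S) :
    ∃ C, S ⊆ C ∧ Γ.IsChamber n C := by
  refine zorn_subset_nonempty {S | Γ.IsSimplex n S} (fun c hc hchain _ => ?_) S hS
  refine ⟨⋃₀ c, ⟨?_, ?_⟩, fun s hs => Set.subset_sUnion_of_mem hs⟩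
  · rintro U ⟨s, hs, hU⟩
    exact (hc hs).1 U hU
  · rintro U ⟨s, hs, hU⟩ V ⟨t, ht, hV⟩
    rcases hchain.total hs ht with h | h
    · exact (hc ht).2 U (h hU) V hV
    · exact (hc hs).2 U hU V (h hV)

theorem Incident.eq_of_dim_eq {U V : Set P} (hU : Γ.IsSingular U) (hV : Γ.IsSingular V)
    (h : Γ.Incident n U V) (hd : Γ.dim U = Γ.dim V) : U = V ∨
      (Γ.IsHyperbolic n ∧ Γ.IsMaximalSingular U ∧ Γ.IsMaximalSingular V ∧
        Γ.rk (U ∩ V) + 1 = n) := by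
  rcases h with h | h | h
  · exact Or.inl (hV.eq_of_dim_le hU h hd.ge)
  · exact Or.inl (hU.eq_of_dim_le hV h hd.le).symm
  · exact Or.inr h

theorem isSimplex_singleton {U : Set P} (hU : Γ.IsVertex n U) : Γ.IsSimplex n {U} := by
  refine ⟨?_, ?_⟩
  · rintro V rfl; exact hU
  · rintro V rfl W rfl; exact Or.inl subset_rfl

/-- Opposite subspaces have equal dimension, and a chamber through `{x}` has no other vertex of
dimension 1: distinct incident vertices of equal dimension are maximal, which the rank excludes
here. So `{x}` can only be opposite its own image. -/
theorem isAnisotropic_iff (hrank : Γ.HasRank n) (hn : 3 ≤ n) (hθ : Γ.IsCollineation θ) :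
    Γ.IsAnisotropic n θ ↔ ∀ x, ¬ Γ.Collinear x (θ x) := by
  constructor
  · intro h x
    have hxs := isSingular_singleton (Γ := Γ) x
    have hv : Γ.IsVertex n {x} := by
      refine ⟨hxs, Set.singleton_nonempty x, fun _ h => ?_⟩
      rw [hxs.rk_eq, dim_singleton] at h
      have : 1 + 1 = n := by exact_mod_cast h
      omega
    obtain ⟨C, hxC, hC⟩ := exists_isChamber (isSimplex_singleton hv)
    obtain ⟨-, ⟨W, hW, rfl⟩, hopp⟩ := (h C hC).1 {x} (hxC rfl)
    have hWs := (hC.1.1 W hW).1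
    have hd := hopp.dim_eq hxs (hWs.image hθ)
    rw [hWs.dim_image hθ] at hd
    rcases (hC.1.2 {x} (hxC rfl) W hW).eq_of_dim_eq hxs hWs hd with h1 | h1
    · subst h1
      obtain ⟨y, hy, hxy⟩ := hopp.1 x rfl
      have hy' : y = θ x := by simpa using hy
      rwa [hy'] at hxy
    · have := hrank.dim_eq h1.2.1
      rw [dim_singleton] at this
      omega
  · intro h S _
    refine ⟨fun U hU => ⟨_, Set.mem_image_of_mem _ hU,
      opposite_image_of_forall_not_collinear h U⟩, ?_⟩
    rintro _ ⟨U, hU, rfl⟩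
    exact ⟨U, hU, opposite_image_of_forall_not_collinear h U⟩

/-! ### Linewise kangaroos -/

theorem IsLinewiseKangaroo.not_collinear_of_collinear (hk : Γ.IsLinewiseKangaroo θ)
    (hrank : Γ.HasRank n) (hn : 3 ≤ n) (hθ : Γ.IsCollineation θ) {p q : P}
    (hp : ¬ Γ.Collinear p (θ p)) (hqp : Γ.Collinear q p) : ¬ Γ.Collinear q (θ q) := by
  intro hq
  have hA : ∀ L ∈ Γ.lines, p ∈ L → Γ.Opposite L (θ '' L) := fun L hL hpL =>
    (hk L hL).resolve_left fun h => hp (h.collinear hpL (Set.mem_image_of_mem _ hpL))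
  -- If `M` were coplanar with its image, a point `θ r` of the image collinear to `p` would also be
  -- collinear to `r`, hence to the whole line `pr`. But that line passes through `p`, so it is
  -- opposite its image.
  have hB : ∀ M ∈ Γ.lines, (∀ m ∈ M, Γ.Collinear p m) → Γ.Opposite M (θ '' M) := by
    intro M hM hMp
    by_cases hpM : p ∈ M
    · exact hA M hM hpM
    refine (hk M hM).resolve_left fun hco => ?_
    obtain ⟨-, ⟨r, hr, rfl⟩, hpr⟩ := exists_collinear_mem_line p (hθ.image_line hM)
    have hrr : Γ.Collinear r (θ r) := hco.collinear hr (Set.mem_image_of_mem _ hr)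
    have hne : p ≠ r := by rintro rfl; exact hpM hr
    obtain ⟨L, hL, hpL, hrL⟩ := (hMp r hr).exists_line hne
    obtain ⟨w, hw, hwn⟩ := (hA L hL hpL).2 (θ r) (Set.mem_image_of_mem _ hrL)
    exact hwn (collinear_line_of_two hL hpL hrL hne hpr.symm hrr.symm hw).symm
  have hpq : p ≠ q := by rintro rfl; exact hp hq
  obtain ⟨L, hL, hpL, hqL⟩ := hqp.symm.exists_line hpq
  set a := θ.symm q with ha
  have haq : Γ.Collinear a q := by
    rw [← hθ.collinear_iff, ha, Equiv.apply_symm_apply]; exact hq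
  -- With `a` the preimage of `q`, a line `M` through `q` inside the perps of `a` and `p` gives a
  -- contradiction: applying `θ` makes `q` collinear to all of `θ '' M`, while `hB` makes `M`
  -- opposite `θ '' M`. If `a` and `p` are not collinear, `M` is found in a plane through `L`.
  obtain ⟨M, hM, hqM, hMp, hMa⟩ : ∃ M ∈ Γ.lines, q ∈ M ∧ (∀ m ∈ M, Γ.Collinear p m) ∧
      ∀ m ∈ M, Γ.Collinear a m := by
    by_cases hap : Γ.Collinear a p
    · exact ⟨L, hL, hqL, fun m hm => collinear_of_mem_line hL hpL hm,
        fun m hm => collinear_line_of_two hL hpL hqL hpq hap haq hm⟩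
    · obtain ⟨r, hr, hrL⟩ := hrank.exists_mem_perp (isSingular_line hL)
        (by rw [dim_line hL]; omega)
      have hpr : p ≠ r := by rintro rfl; exact hrL hpL
      obtain ⟨K, hK, hpK, hrK⟩ := (hr p hpL).symm.exists_line hpr
      obtain ⟨s, hsK, has⟩ := exists_collinear_mem_line a hK
      have hqK : Γ.Collinear q s := collinear_line_of_two hK hpK hrK hpr hqp (hr q hqL).symm hsK
      have hqs : q ≠ s := by
        rintro rfl
        have : K = L := Γ.line_unique K hK L hL p q hpq hpK hsK hpL hqL
        exact hrL (this ▸ hrK)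
      obtain ⟨M, hM, hqM, hsM⟩ := hqK.exists_line hqs
      exact ⟨M, hM, hqM, fun m hm => collinear_line_of_two hM hqM hsM hqs hqp.symm
          (collinear_of_mem_line hK hpK hsK) hm,
        fun m hm => collinear_line_of_two hM hqM hsM hqs haq has hm⟩
  obtain ⟨-, ⟨m, hm, rfl⟩, hqm⟩ := (hB M hM hMp).1 q hqM
  have := hθ.map_collinear (hMa m hm)
  rw [ha, Equiv.apply_symm_apply] at this
  exact hqm this

theorem IsLinewiseKangaroo.forall_not_collinear (hk : Γ.IsLinewiseKangaroo θ)
    (hrank : Γ.HasRank n) (hn : 3 ≤ n) (hθ : Γ.IsCollineation θ) {p : P}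
    (hp : ¬ Γ.Collinear p (θ p)) (w : P) : ¬ Γ.Collinear w (θ w) := by
  obtain ⟨L, hL, hpL⟩ := hrank.exists_line hn p
  obtain ⟨q, hqL, hwq⟩ := exists_collinear_mem_line w hL
  have hq := hk.not_collinear_of_collinear hrank hn hθ hp (collinear_of_mem_line hL hqL hpL)
  exact hk.not_collinear_of_collinear hrank hn hθ hq hwq

theorem IsLinewiseKangaroo.forall_collinear (hk : Γ.IsLinewiseKangaroo θ)
    (hrank : Γ.HasRank n) (hn : 3 ≤ n) (hθ : Γ.IsCollineation θ) (ha : ¬ Γ.IsAnisotropic n θ)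
    (x : P) : Γ.Collinear x (θ x) := by
  by_contra hx
  exact ha ((isAnisotropic_iff hrank hn hθ).2 (hk.forall_not_collinear hrank hn hθ hx))

theorem IsLinewiseKangaroo.onlyLinesToOpposite (hk : Γ.IsLinewiseKangaroo θ)
    (hθ : Γ.IsCollineation θ) (h : ∀ x, Γ.Collinear x (θ x)) : Γ.OnlyLinesToOpposite θ := by
  intro U hU ⟨x, hx⟩ hopp
  by_contra hUl
  have hfix : ∀ y ∈ U, ∀ z ∈ U, y ≠ θ z := fun y hy z hz he =>
    hopp.disjoint (hU.image hθ) hy (he ▸ Set.mem_image_of_mem _ hz)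
  have hd : 2 ≤ Γ.dim U := by
    by_contra hd
    have hxU : ({x} : Set P) = U := hU.eq_of_dim_le (isSingular_singleton x)
      (Set.singleton_subset_iff.2 hx) (by rw [dim_singleton]; omega)
    subst hxU
    obtain ⟨-, ⟨y, rfl, rfl⟩, hxy⟩ := hopp.1 x rfl
    exact hxy (h _)
  obtain ⟨L, hL, hxL, hLU⟩ := hU.exists_line_of_mem hd hx
  have hUL : ¬ U ⊆ L := fun h' => hUl (Set.Subset.antisymm h' hLU ▸ hL)
  obtain ⟨y, hy, hyL⟩ := Set.not_subset.1 hUL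
  obtain ⟨z, hzL, hzx, -⟩ := exists_third_mem_line hL x x
  have hyz : y ≠ z := by rintro rfl; exact hyL hzL
  obtain ⟨K, hK, hyK, hzK⟩ := (hU.2 y hy z (hLU hzL)).exists_line hyz
  -- `K` is a line of `U` avoiding `x`. Choosing `w` on it collinear to `θ x` makes the line `xw`
  -- totally isotropic.
  obtain ⟨w, hwK, hw⟩ := exists_collinear_mem_line (θ x) hK
  have hwU : w ∈ U := hU.1 K hK y hyK z hzK hyz hy (hLU hzL) hwK
  have hxw : x ≠ w := by
    rintro rfl
    have : K = L := Γ.line_unique K hK L hL x z hzx.symm hwK hzK hxL hzL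
    exact hyL (this ▸ hyK)
  obtain ⟨M, hM, hxM, hwM⟩ := (hU.2 x hx w hwU).exists_line hxw
  have hMU : M ⊆ U := hU.1 M hM x hxM w hwM hxw hx hwU
  rcases hk M hM with hco | ho
  · obtain ⟨u, hu, v, hv, rfl⟩ := hco.exists_mem_inter hM (hθ.image_line hM)
    exact hfix _ (hMU hu) v (hMU hv) rfl
  · obtain ⟨u, hu, hun⟩ := ho.2 (θ x) (Set.mem_image_of_mem _ hxM)
    exact hun (collinear_line_of_two hM hxM hwM hxw (h x).symm hw hu).symm

/-! ### Collineations that map no point to an opposite one -/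

/-- If `x` is collinear to all of `θ '' L`, then for `z ≠ x` on `L` the point `θ z` is collinear to
both `z` and `x`, hence to all of `L`. Two such `z` exist because lines have three points, and their
images span `θ '' L`. -/
theorem collinear_of_not_opposite (hθ : Γ.IsCollineation θ) (h : ∀ x, Γ.Collinear x (θ x))
    {L : Set P} (hL : L ∈ Γ.lines) (hno : ¬ Γ.Opposite L (θ '' L)) :
    ∀ x ∈ L, ∀ y ∈ L, Γ.Collinear x (θ y) := by
  have right : ∀ {z x y w}, x ∈ L → y ∈ L → x ≠ y → Γ.Collinear z (θ x) → Γ.Collinear z (θ y) →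
      w ∈ L → Γ.Collinear z (θ w) := fun hx hy hxy h1 h2 hw =>
    collinear_line_of_two (hθ.image_line hL) (Set.mem_image_of_mem _ hx)
      (Set.mem_image_of_mem _ hy) (fun h => hxy (θ.injective h)) h1 h2 (Set.mem_image_of_mem _ hw)
  have left : ∀ {z x y w}, x ∈ L → y ∈ L → x ≠ y → Γ.Collinear x (θ z) → Γ.Collinear y (θ z) →
      w ∈ L → Γ.Collinear w (θ z) := fun hx hy hxy h1 h2 hw =>
    (collinear_line_of_two hL hx hy hxy h1.symm h2.symm hw).symm
  rw [Opposite, not_and_or] at hno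
  push Not at hno
  rcases hno with ⟨x, hx, hxL⟩ | ⟨_, ⟨x, hx, rfl⟩, hxL⟩
  · have h1 : ∀ z ∈ L, z ≠ x → ∀ u ∈ L, Γ.Collinear u (θ z) := fun z hz hzx u hu =>
      left hz hx hzx (h z) (hxL _ (Set.mem_image_of_mem _ hz)) hu
    obtain ⟨z, hz, hzx, -⟩ := exists_third_mem_line hL x x
    obtain ⟨w, hw, hwx, hwz⟩ := exists_third_mem_line hL x z
    exact fun u hu v hv => right hz hw hwz.symm (h1 z hz hzx u hu) (h1 w hw hwx u hu) hv
  · have h1 : ∀ z ∈ L, z ≠ x → ∀ u ∈ L, Γ.Collinear z (θ u) := fun z hz hzx u hu =>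
      right hz hx hzx (h z) (hxL z hz) hu
    obtain ⟨z, hz, hzx, -⟩ := exists_third_mem_line hL x x
    obtain ⟨w, hw, hwx, hwz⟩ := exists_third_mem_line hL x z
    exact fun u hu v hv => left hz hw hwz.symm (h1 z hz hzx v hv) (h1 w hw hwx v hv) hu

theorem collinear_image_line_of_collinear (hθ : Γ.IsCollineation θ)
    (h : ∀ x, Γ.Collinear x (θ x)) {L : Set P} (hL : L ∈ Γ.lines) {x y : P} (hx : x ∈ L)
    (hy : y ∈ L) (hxy : x ≠ y) (hc : Γ.Collinear x (θ y)) :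
    ∀ u ∈ L, ∀ v ∈ L, Γ.Collinear u (θ v) := by
  refine collinear_of_not_opposite hθ h hL fun ho => ?_
  obtain ⟨_, ⟨z, hz, rfl⟩, hzn⟩ := ho.1 x hx
  exact hzn (collinear_line_of_two (hθ.image_line hL) (Set.mem_image_of_mem _ hx)
    (Set.mem_image_of_mem _ hy) (fun h => hxy (θ.injective h)) (h x) hc (Set.mem_image_of_mem _ hz))

theorem collinear_image_symm (hθ : Γ.IsCollineation θ) (h : ∀ x, Γ.Collinear x (θ x)) {x y : P}
    (hxy : Γ.Collinear x y) (hc : Γ.Collinear x (θ y)) : Γ.Collinear y (θ x) := by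
  by_cases he : x = y
  · subst he; exact h x
  obtain ⟨L, hL, hx, hy⟩ := hxy.exists_line he
  exact collinear_image_line_of_collinear hθ h hL hx hy he hc y hy x hx

/-- If `θ x ≠ x`, some `z` collinear to `x` is not collinear to `θ x`, and then the line `zx` is
opposite its image. -/
theorem exists_line_opposite (hθ : Γ.IsCollineation θ) (h : ∀ x, Γ.Collinear x (θ x))
    (hne : θ ≠ 1) : ∃ L ∈ Γ.lines, Γ.Opposite L (θ '' L) := by
  by_contra! hno
  refine hne (Equiv.ext fun x => ?_)
  by_contra hx
  obtain ⟨z, hz, hzn⟩ := (isSingular_singleton (Γ := Γ) x).exists_not_collinear (y := θ x) hx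
  have hzx : z ≠ x := by rintro rfl; exact hzn (h z)
  obtain ⟨L, hL, hzL, hxL⟩ := (hz x rfl).exists_line hzx
  exact hzn (collinear_of_not_opposite hθ h hL (hno L hL) z hzL x hxL)

theorem OnlyLinesToOpposite.forall_collinear (ho : Γ.OnlyLinesToOpposite θ) (x : P) :
    Γ.Collinear x (θ x) := by
  by_contra hx
  have h1 : ({x} : Set P) ∈ Γ.lines := by
    refine ho {x} (isSingular_singleton x) (Set.singleton_nonempty x) ⟨?_, ?_⟩ <;> simpa
  have := dim_line h1
  rw [dim_singleton] at this
  omega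

theorem HasRank.coplanar (hrank : Γ.HasRank n) (hn : 3 ≤ n) {L M : Set P} (hL : L ∈ Γ.lines)
    (hM : M ∈ Γ.lines) (h : ∀ x ∈ L, ∀ y ∈ M, Γ.Collinear x y) {x : P} (hxL : x ∈ L)
    (hxM : x ∈ M) : Γ.Coplanar L M := by
  have hLs := isSingular_line hL
  obtain ⟨y, hyp, hyL, hMy⟩ : ∃ y ∈ Γ.perp L, y ∉ L ∧ M ⊆ Γ.cl (insert y L) := by
    by_cases hML : M ⊆ L
    · obtain ⟨y, hy, hyL⟩ := hrank.exists_mem_perp hLs (by rw [dim_line hL]; omega)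
      exact ⟨y, hy, hyL, hML.trans (subset_cl_insert y L)⟩
    · obtain ⟨y, hy, hyL⟩ := Set.not_subset.1 hML
      have hyp : y ∈ Γ.perp L := fun z hz => (h z hz y hy).symm
      exact ⟨y, hyp, hyL, (hLs.cl_insert hyp).1 M hM x hxM y hy (by rintro rfl; exact hyL hxL)
        (subset_cl_insert y L hxL) (mem_cl_insert y L)⟩
  have hU := hLs.cl_insert hyp
  refine ⟨_, hU, ?_, subset_cl_insert y L, hMy⟩
  rw [hU.rk_eq, hLs.dim_cl_insert hyp hyL, dim_line hL]
  rfl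

theorem IsSingular.mem_of_mem_cl_insert {W : Set P} (hW : Γ.IsSingular W) {p b z : P}
    (hWp : ∀ w ∈ W, Γ.Collinear w p) (hb : b ∈ Γ.perp W) (hbp : ¬ Γ.Collinear b p)
    (hz : z ∈ Γ.cl (insert b W)) (hzp : Γ.Collinear z p) : z ∈ W := by
  have hbW : b ∉ W := fun h => hbp (hWp b h)
  have hbz : b ≠ z := by rintro rfl; exact hbp hzp
  obtain ⟨K, hK, hbK, hzK, u, hu, huK⟩ := hW.exists_mem_line hb hbW hbz hz
  by_contra hzW
  have hzu : z ≠ u := by rintro rfl; exact hzW hu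
  exact hbp (collinear_line_of_two hK hzK huK hzu hzp.symm (hWp u hu).symm hbK).symm

/-- The point `u` lies outside the span of `L` and `v`, since otherwise the line `uv = M` would meet
`L`. Closure under double perp then separates `u` from this span. -/
theorem exists_mem_perp_line_not_collinear {L M : Set P} (hL : L ∈ Γ.lines) (hM : M ∈ Γ.lines)
    (h : ∀ x ∈ L, ∀ y ∈ M, Γ.Collinear x y) (hdisj : ∀ x ∈ L, x ∉ M) {u v : P} (hu : u ∈ M)
    (hv : v ∈ M) (huv : u ≠ v) : ∃ a ∈ Γ.perp L, Γ.Collinear a v ∧ ¬ Γ.Collinear a u := by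
  have hLs := isSingular_line hL
  have hvp : v ∈ Γ.perp L := fun x hx => (h x hx v hv).symm
  have hun : u ∉ Γ.cl (insert v L) := by
    intro huc
    obtain ⟨K, hK, hvK, huK, w, hw, hwK⟩ :=
      hLs.exists_mem_line hvp (fun hvL => hdisj v hvL hv) huv.symm huc
    exact hdisj w hw (Γ.line_unique K hK M hM u v huv huK hvK hu hv ▸ hwK)
  obtain ⟨a, ha, hau⟩ := (hLs.cl_insert hvp).exists_not_collinear hun
  rw [perp_cl_insert] at ha
  exact ⟨a, ha.1, ha.2 v rfl, hau⟩

/-- Suppose `L` is totally isotropic and disjoint from `θ '' L`. The points `a` and `b` are chosen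
dual to `x, y ∈ L`: `a` pairs nontrivially with `x` only, `b` with `y` only. The form on the span of
`L`, `a`, `b` then has empty radical, so this span is opposite its image without being a line. -/
theorem OnlyLinesToOpposite.isLinewiseKangaroo (ho : Γ.OnlyLinesToOpposite θ)
    (hrank : Γ.HasRank n) (hn : 3 ≤ n) (hθ : Γ.IsCollineation θ) : Γ.IsLinewiseKangaroo θ := by
  intro L hL
  have h := ho.forall_collinear
  by_cases hLo : Γ.Opposite L (θ '' L)
  · exact Or.inr hLo
  left
  have hLs := isSingular_line hL
  have hM := hθ.image_line hL
  have hLL := collinear_of_not_opposite hθ h hL hLo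
  have hLM : ∀ x ∈ L, ∀ y ∈ θ '' L, Γ.Collinear x y := by
    rintro x hx _ ⟨y, hy, rfl⟩; exact hLL x hx y hy
  by_contra hco
  have hdisj : ∀ x ∈ L, x ∉ θ '' L := fun x hxL hxM => hco (hrank.coplanar hn hL hM hLM hxL hxM)
  obtain ⟨x, hx⟩ := nonempty_of_mem_lines hL
  obtain ⟨y, hy, hyx, -⟩ := exists_third_mem_line hL x x
  have hne : θ x ≠ θ y := fun h => hyx (θ.injective h).symm
  have hx' := Set.mem_image_of_mem θ hx
  have hy' := Set.mem_image_of_mem θ hy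
  obtain ⟨a, ha, hay, hax⟩ := exists_mem_perp_line_not_collinear hL hM hLM hdisj hx' hy' hne
  obtain ⟨c, hc, hcx, hcy⟩ := exists_mem_perp_line_not_collinear hL hM hLM hdisj hy' hx' hne.symm
  have hcol : Γ.Collinear (θ x) (θ y) := collinear_of_mem_line hM hx' hy'
  have hcne : c ≠ θ x := by rintro rfl; exact hcy hcol
  obtain ⟨N, hN, hcN, hxN⟩ := hcx.exists_line hcne
  -- `c` need not be collinear to `a`. Moving it along the line towards `θ x` corrects this and
  -- keeps it non-collinear to `θ y`.
  obtain ⟨b, hbN, hab⟩ := exists_collinear_mem_line a hN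
  have hbne : b ≠ θ x := by rintro rfl; exact hax hab
  have hb : b ∈ Γ.perp L := isSubspace_perp L N hN c hcN _ hxN hcne hc
    (fun z hz => (hLM z hz _ hx').symm) hbN
  have hbx : Γ.Collinear b (θ x) := collinear_of_mem_line hN hbN hxN
  have hby : ¬ Γ.Collinear b (θ y) := fun hby =>
    hcy (collinear_line_of_two hN hbN hxN hbne hby.symm hcol.symm hcN).symm
  have hV := hLs.cl_insert ha
  have hbV : b ∈ Γ.perp (Γ.cl (insert a L)) := by
    rw [perp_cl_insert]; exact ⟨hb, by rintro z rfl; exact hab.symm⟩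
  have hU := hV.cl_insert hbV
  set V := Γ.cl (insert a L) with hVdef
  set U := Γ.cl (insert b V) with hUdef
  have hVU : V ⊆ U := subset_cl_insert b V
  have hLV : L ⊆ V := subset_cl_insert a L
  have haU : a ∈ U := hVU (mem_cl_insert a L)
  have hbU : b ∈ U := mem_cl_insert b V
  have hVy : ∀ w ∈ V, Γ.Collinear w (θ y) := fun w hw =>
    hw (θ y) (mem_perp_insert.2 ⟨hay.symm, fun z hz => (hLL z hz y hy).symm⟩)
  -- A radical point `z` is pushed into `V` by pairing with `y` and into `L` by pairing with `x`;
  -- pairing with `a` then leaves only `z = y`, which `b` excludes.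
  have key : ∀ z ∈ U, ∃ w ∈ U, ¬ Γ.Collinear z (θ w) := by
    intro z hz
    by_contra! hzU
    have hzV : z ∈ V := hV.mem_of_mem_cl_insert hVy hbV hby hz (hzU y (hVU (hLV hy)))
    have hzL : z ∈ L := hLs.mem_of_mem_cl_insert (fun w hw => hLL w hw x hx) ha hax hzV
      (hzU x (hVU (hLV hx)))
    have hya : Γ.Collinear y (θ a) := collinear_image_symm hθ h (ha y hy) hay
    have hzy : z ≠ y := by
      rintro rfl
      exact hby (collinear_image_symm hθ h (hb z hzL).symm (hzU b hbU))
    exact hax (collinear_image_symm hθ h (ha x hx).symm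
      (collinear_line_of_two hL hzL hy hzy (hzU a haU).symm hya.symm hx).symm)
  have hUo : Γ.Opposite U (θ '' U) := by
    refine ⟨fun z hz => ?_, ?_⟩
    · obtain ⟨w, hw, hzw⟩ := key z hz
      exact ⟨θ w, Set.mem_image_of_mem _ hw, hzw⟩
    · rintro _ ⟨z, hz, rfl⟩
      obtain ⟨w, hw, hzw⟩ := key z hz
      exact ⟨w, hw, fun hwz => hzw (collinear_image_symm hθ h (hU.2 w hw z hz) hwz)⟩
  have hUl := dim_line (ho U hU ⟨b, hbU⟩ hUo)
  have hLU : L = U := hU.eq_of_dim_le hLs (hLV.trans hVU) (by rw [hUl, dim_line hL])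
  exact hax (hLL a (hLU ▸ haU) x hx)

theorem HasRank.isMaximalSingular_image (hrank : Γ.HasRank n) (hθ : Γ.IsCollineation θ) {M : Set P}
    (hM : Γ.IsMaximalSingular M) : Γ.IsMaximalSingular (θ '' M) :=
  hrank.isMaximalSingular (hM.1.image hθ) (by rw [hM.1.dim_image hθ, hrank.dim_eq hM])

/-! ### Hyperbolic polar spaces -/

theorem IsHyperbolic.exists_pair (hh : Γ.IsHyperbolic n) {U : Set P} (hU : Γ.IsSingular U)
    (hd : Γ.dim U + 1 = n) : ∃ M N, M ≠ N ∧ {M | Γ.IsMaximalSingular M ∧ U ⊆ M} = {M, N} := by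
  have h := hh U hU (by rw [hU.rk_eq]; exact_mod_cast hd)
  rwa [Set.encard_eq_two] at h

theorem IsHyperbolic.eq_or_eq (hh : Γ.IsHyperbolic n) {U : Set P} (hU : Γ.IsSingular U)
    (hd : Γ.dim U + 1 = n) {M N K : Set P} (hM : Γ.IsMaximalSingular M)
    (hN : Γ.IsMaximalSingular N) (hK : Γ.IsMaximalSingular K) (hUM : U ⊆ M) (hUN : U ⊆ N)
    (hUK : U ⊆ K) (hMN : M ≠ N) : K = M ∨ K = N := by
  obtain ⟨A, B, -, hAB⟩ := hh.exists_pair hU hd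
  have h1 : M ∈ ({A, B} : Set (Set P)) := hAB ▸ ⟨hM, hUM⟩
  have h2 : N ∈ ({A, B} : Set (Set P)) := hAB ▸ ⟨hN, hUN⟩
  have h3 : K ∈ ({A, B} : Set (Set P)) := hAB ▸ ⟨hK, hUK⟩
  simp only [Set.mem_insert_iff, Set.mem_singleton_iff] at h1 h2 h3
  grind

theorem IsSingular.exists_cl_insert_eq {N U : Set P} (hN : Γ.IsSingular N) (hU : Γ.IsSingular U)
    (hUN : U ⊆ N) (hd : Γ.dim U + 1 = Γ.dim N) {y : P} (hy : y ∈ N) (hyU : y ∉ U) :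
    y ∈ Γ.perp U ∧ Γ.cl (insert y U) = N := by
  have hyp : y ∈ Γ.perp U := perp_anti hUN (hN.subset_perp hy)
  exact ⟨hyp, hN.eq_of_dim_le (hU.cl_insert hyp) (hN.cl_subset (Set.insert_subset hy hUN))
    (by rw [hU.dim_cl_insert hyp hyU, hd])⟩

theorem IsSingular.dim_inter_hyperplane {N U V : Set P} (hN : Γ.IsSingular N)
    (hU : Γ.IsSingular U) (hV : Γ.IsSingular V) (hUN : U ⊆ N) (hd : Γ.dim U + 1 = Γ.dim N)
    (hVN : V ⊆ N) {y : P} (hyV : y ∈ V) (hyU : y ∉ U) : Γ.dim V = Γ.dim (V ∩ U) + 1 := by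
  obtain ⟨hyp, he⟩ := hN.exists_cl_insert_eq hU hUN hd (hVN hyV) hyU
  rw [← (hV.inter hU).dim_cl_insert (x := y) (fun w hw => hV.2 y hyV w hw.1) (fun h => hyU h.2),
    hU.subset_of_hyperplane hV hyp hyU (he.symm ▸ hVN) hyV hyU]

/-- Exactly one of `N` and `N'` meets `M` outside the common hyperplane `U`. Both cannot, since a
point of `M ∩ N'` collinear to `U` and to a point of `N` off `U` lies in `N`. At least one does,
since `N` and `N'` are the only maximal singular subspaces through `U`. -/
theorem IsHyperbolic.dim_inter_adjacent (hh : Γ.IsHyperbolic n) (hrank : Γ.HasRank n)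
    {M N N' : Set P} (hM : Γ.IsMaximalSingular M) (hN : Γ.IsMaximalSingular N)
    (hN' : Γ.IsMaximalSingular N') (hd : Γ.dim (N ∩ N') + 1 = n) :
    Γ.dim (M ∩ N) + 1 = Γ.dim (M ∩ N') ∨ Γ.dim (M ∩ N') + 1 = Γ.dim (M ∩ N) := by
  have hne : N ≠ N' := by
    rintro rfl
    rw [Set.inter_self, hrank.dim_eq hN] at hd
    omega
  have hU := hN.1.inter hN'.1
  set U := N ∩ N' with hUdef
  have hUN : U ⊆ N := Set.inter_subset_left
  have hUN' : U ⊆ N' := Set.inter_subset_right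
  have d1 : Γ.dim U + 1 = Γ.dim N := by rw [hd, hrank.dim_eq hN]
  have d2 : Γ.dim U + 1 = Γ.dim N' := by rw [hd, hrank.dim_eq hN']
  by_cases h1 : M ∩ N ⊆ U <;> by_cases h2 : M ∩ N' ⊆ U
  · exfalso
    -- The count shows that `M ∩ Γ.perp U` is strictly larger than `M ∩ U`; an extra point `z` spans
    -- with `U` a maximal subspace, which must be `N` or `N'`.
    have h3 := hM.1.dim_inter_perp hU (hM.1.inter hU) Set.inter_subset_right
    have h4 : M ∩ Γ.perp (M ∩ U) = M :=
      Set.inter_eq_left.2 fun x hx y hy => hM.1.2 x hx y hy.1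
    rw [h4, hrank.dim_eq hM] at h3
    have h5 : ¬ M ∩ Γ.perp U ⊆ M ∩ U := fun h => by
      have := (hM.1.inter hU).dim_le (hM.1.inter_perp U) h
      omega
    obtain ⟨z, ⟨hzM, hzp⟩, hz⟩ := Set.not_subset.1 h5
    have hzU : z ∉ U := fun h => hz ⟨hzM, h⟩
    have hK := hrank.isMaximalSingular (hU.cl_insert hzp)
      (by rw [hU.dim_cl_insert hzp hzU, hd])
    rcases hh.eq_or_eq hU hd hN hN' hK hUN hUN' (subset_cl_insert z U) hne with h | h
    · exact hzU (h1 ⟨hzM, h ▸ mem_cl_insert z U⟩)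
    · exact hzU (h2 ⟨hzM, h ▸ mem_cl_insert z U⟩)
  · obtain ⟨y, hy, hyU⟩ := Set.not_subset.1 h2
    have h3 := hN'.1.dim_inter_hyperplane hU (hM.1.inter hN'.1) hUN' d2 Set.inter_subset_right
      hy hyU
    have h4 : M ∩ N' ∩ U = M ∩ N := by
      ext x
      exact ⟨fun h => ⟨h.1.1, hUN h.2⟩, fun h => ⟨⟨h.1, hUN' (h1 h)⟩, h1 h⟩⟩
    rw [h4] at h3
    exact Or.inl h3.symm
  · obtain ⟨y, hy, hyU⟩ := Set.not_subset.1 h1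
    have h3 := hN.1.dim_inter_hyperplane hU (hM.1.inter hN.1) hUN d1 Set.inter_subset_right
      hy hyU
    have h4 : M ∩ N ∩ U = M ∩ N' := by
      ext x
      exact ⟨fun h => ⟨h.1.1, hUN' h.2⟩, fun h => ⟨⟨h.1, hUN (h2 h)⟩, h2 h⟩⟩
    rw [h4] at h3
    exact Or.inr h3.symm
  · exfalso
    obtain ⟨y, hy, hyU⟩ := Set.not_subset.1 h1
    obtain ⟨z, hz, hzU⟩ := Set.not_subset.1 h2
    obtain ⟨hyp, he⟩ := hN.1.exists_cl_insert_eq hU hUN d1 hy.2 hyU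
    have hzN : z ∈ N := hN.mem_of_mem_perp (by
      rw [← he, perp_cl, mem_perp_insert]
      exact ⟨hM.1.2 z hz.1 y hy.1, fun w hw => hN'.1.2 z hz.2 w (hUN' hw)⟩)
    exact hzU ⟨hzN, hz.2⟩

/-- Replace `N` by the span of a point `z` of `K` off `N` and the hyperplane of `N` collinear to
`z`. This keeps `K ∩ N` and gains `z`. -/
theorem HasRank.exists_adjacent (hrank : Γ.HasRank n) {N K : Set P} (hN : Γ.IsMaximalSingular N)
    (hK : Γ.IsMaximalSingular K) (hne : N ≠ K) :
    ∃ N', Γ.IsMaximalSingular N' ∧ Γ.dim (N ∩ N') + 1 = n ∧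
      Γ.dim (K ∩ N) < Γ.dim (K ∩ N') := by
  have hKN : ¬ K ⊆ N := fun h => hne (Set.Subset.antisymm (hK.2 hN.1 h) h)
  obtain ⟨z, hzK, hzN⟩ := Set.not_subset.1 hKN
  have hU := hN.1.inter_perp {z}
  have hzU : z ∉ N ∩ Γ.perp {z} := fun h => hzN h.1
  have hzp : z ∈ Γ.perp (N ∩ Γ.perp {z}) := fun w hw => (hw.2 z rfl).symm
  have hd := hN.1.dim_le_inter_perp_singleton z
  rw [hrank.dim_eq hN] at hd
  have hN's := hU.cl_insert hzp
  have hN'd := hU.dim_cl_insert hzp hzU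
  have hN' := hrank.isMaximalSingular hN's (by rw [hN'd]; exact hd)
  have hzN' := mem_cl_insert (Γ := Γ) z (N ∩ Γ.perp {z})
  have hsub := subset_cl_insert (Γ := Γ) z (N ∩ Γ.perp {z})
  refine ⟨_, hN', ?_, ?_⟩
  · have h1 := hN's.dim_lt (hN.1.inter hN's) Set.inter_subset_right hzN' (fun h => hzN h.1)
    have h2 := (hN.1.inter hN's).dim_le hU (Set.subset_inter Set.inter_subset_left hsub)
    rw [hrank.dim_eq hN'] at h1
    omega
  · refine (hK.1.inter hN's).dim_lt (hK.1.inter hN.1) (fun w hw => ⟨hw.1, hsub ⟨hw.2, ?_⟩⟩)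
      ⟨hzK, hzN'⟩ (fun h => hzN h.2)
    rintro _ rfl
    exact hK.1.2 w hw.1 _ hzK

/-- Codimension parity is an equivalence relation with at most two classes. Moving `N` one step
towards `K` changes both `dim (M ∩ N)` and `dim (K ∩ N)` by one, so the parity of the sum is
constant, and it is even at `N = K`. -/
theorem IsHyperbolic.parity (hh : Γ.IsHyperbolic n) (hrank : Γ.HasRank n) {M N K : Set P}
    (hM : Γ.IsMaximalSingular M) (hN : Γ.IsMaximalSingular N) (hK : Γ.IsMaximalSingular K) :
    (Γ.dim (M ∩ N) + Γ.dim (K ∩ N) + Γ.dim (M ∩ K) + n) % 2 = 0 := by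
  obtain ⟨d, hd⟩ := Nat.exists_eq_add_of_le (hrank.dim_le (hK.1.inter hN.1))
  induction d generalizing N with
  | zero =>
    have h1 := hN.1.eq_of_dim_le (hK.1.inter hN.1) Set.inter_subset_right
      (by rw [hrank.dim_eq hN]; omega)
    have h2 := hK.1.eq_of_dim_le (hK.1.inter hN.1) Set.inter_subset_left
      (by rw [hrank.dim_eq hK]; omega)
    have : N = K := h1.symm.trans h2
    subst this
    omega
  | succ d ih =>
    have hne : N ≠ K := by
      rintro rfl
      rw [Set.inter_self, hrank.dim_eq hN] at hd
      omega
    obtain ⟨N', hN', hadj, hlt⟩ := hrank.exists_adjacent hN hK hne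
    have h1 := hh.dim_inter_adjacent hrank hK hN hN' hadj
    have h2 := hh.dim_inter_adjacent hrank hM hN hN' hadj
    have h3 := ih hN' (by omega)
    omega

/-! ### Action of kangaroos on maximal singular subspaces -/

/-- If `M` is not fixed, it contains a line `L` opposite its image. The kangaroo property puts `M ∩
Γ.perp (θ '' L)`, of codimension at most 2, inside `θ '' M`. Codimension 1 is impossible, since `L`
would then meet `θ '' M` in a point collinear to all of `θ '' L`. -/
theorem IsLinewiseKangaroo.dim_inter_image (hk : Γ.IsLinewiseKangaroo θ) (hrank : Γ.HasRank n)
    (hθ : Γ.IsCollineation θ) (h : ∀ x, Γ.Collinear x (θ x)) {M : Set P}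
    (hM : Γ.IsMaximalSingular M) : Γ.dim (M ∩ θ '' M) = n ∨ Γ.dim (M ∩ θ '' M) + 2 = n := by
  have hM' := hrank.isMaximalSingular_image hθ hM
  have hR := hM.1.inter hM'.1
  by_cases hMM : M ⊆ θ '' M
  · left
    rw [Set.inter_eq_left.2 hMM, hrank.dim_eq hM]
  right
  obtain ⟨x, hxM, hx⟩ := Set.not_subset.1 hMM
  obtain ⟨y, hyM, hxy⟩ : ∃ y ∈ M, ¬ Γ.Collinear x (θ y) := by
    by_contra! hc
    refine hx (hM'.mem_of_mem_perp ?_)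
    rintro _ ⟨y, hy, rfl⟩
    exact hc y hy
  have hne : x ≠ y := by rintro rfl; exact hxy (h x)
  obtain ⟨L, hL, hxL, hyL⟩ := (hM.1.2 x hxM y hyM).exists_line hne
  have hLM : L ⊆ M := hM.1.1 L hL x hxL y hyL hne hxM hyM
  have hLo : Γ.Opposite L (θ '' L) := by
    by_contra hno
    exact hxy (collinear_of_not_opposite hθ h hL hno x hxL y hyL)
  have hL' := hθ.image_line hL
  have hKR : M ∩ Γ.perp (θ '' L) ⊆ M ∩ θ '' M := by
    rintro z ⟨hzM, hz⟩
    by_contra hzR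
    have hzx : z ≠ x := by rintro rfl; exact hxy (hz _ (Set.mem_image_of_mem _ hyL))
    obtain ⟨N, hN, hzN, hxN⟩ := (hM.1.2 z hzM x hxM).exists_line hzx
    have hNM : N ⊆ M := hM.1.1 N hN z hzN x hxN hzx hzM hxM
    -- The line `zx` is totally isotropic, so it meets its image in some `r ≠ z`. Both `z` and `r`
    -- are collinear to `θ y`, hence so is `x`.
    have hNN := collinear_image_line_of_collinear hθ h hN hzN hxN hzx
      (hz _ (Set.mem_image_of_mem _ hxL))
    rcases hk N hN with hco | ho
    · obtain ⟨r, hrN, hr⟩ := hco.exists_mem_inter hN (hθ.image_line hN)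
      have hrM : r ∈ θ '' M := Set.image_mono hNM hr
      have hrz : z ≠ r := by rintro rfl; exact hzR ⟨hzM, hrM⟩
      exact hxy (collinear_line_of_two hN hzN hrN hrz
        (hz _ (Set.mem_image_of_mem _ hyL)).symm
        (hM'.1.2 _ (Set.mem_image_of_mem _ hyM) r hrM) hxN).symm
    · obtain ⟨-, ⟨w, hw, rfl⟩, hzw⟩ := ho.1 z hzN
      exact hzw (hNN z hzN w hw)
  have h1 := hM.1.dim_inter_perp (isSingular_line hL') isSingular_empty (Set.empty_subset _)
  rw [perp_empty, Set.inter_univ, hrank.dim_eq hM, dim_empty, dim_line hL'] at h1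
  have h2 := hR.dim_le (hM.1.inter_perp _) hKR
  have h3 := hM.1.dim_lt hR Set.inter_subset_left hxM (fun h => hx h.2)
  rw [hrank.dim_eq hM] at h3
  have h4 : Γ.dim (M ∩ θ '' M) + 1 ≠ n := by
    intro h4
    have hxR : x ∉ M ∩ θ '' M := fun h => hx h.2
    obtain ⟨hxp, he⟩ := hM.1.exists_cl_insert_eq hR Set.inter_subset_left
      (by rw [h4, hrank.dim_eq hM]) hxM hxR
    obtain ⟨u, hu, huL⟩ := hR.line_meets hxp hxR hL hne hxL hyL (he.symm ▸ hxM) (he.symm ▸ hyM)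
    obtain ⟨v, hv, huv⟩ := hLo.1 u huL
    exact huv (hM'.1.2 u hu.2 v (Set.image_mono hLM hv))
  omega

/-- Opposition makes `U ∩ θ '' U'` empty, so by adjacency `U ∩ θ '' U` is a point; its dimension
must be `n` or `n - 2`. -/
theorem IsLinewiseKangaroo.rank_eq_three (hk : Γ.IsLinewiseKangaroo θ) (hrank : Γ.HasRank n)
    (hn : 3 ≤ n) (hθ : Γ.IsCollineation θ) (h : ∀ x, Γ.Collinear x (θ x))
    (hh : Γ.IsHyperbolic n) {U U' : Set P} (hU : Γ.IsMaximalSingular U)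
    (hU' : Γ.IsMaximalSingular U') (hd : Γ.dim (U ∩ U') + 1 = n)
    (ho : Γ.Opposite U (θ '' U')) : n = 3 := by
  have hθU := hrank.isMaximalSingular_image hθ hU
  have hθU' := hrank.isMaximalSingular_image hθ hU'
  have hd' : Γ.dim (θ '' U ∩ θ '' U') + 1 = n := by
    rw [← Set.image_inter θ.injective, (hU.1.inter hU'.1).dim_image hθ, hd]
  have h1 := hh.dim_inter_adjacent hrank hU hθU hθU' hd'
  have h2 : U ∩ θ '' U' = ∅ :=
    Set.eq_empty_iff_forall_notMem.2 fun x hx => ho.disjoint hθU'.1 hx.1 hx.2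
  have h3 := hk.dim_inter_image hrank hθ h hU
  rw [h2, dim_empty] at h1
  omega

theorem IsMaximalSingular.opposite {U V : Set P} (hU : Γ.IsMaximalSingular U)
    (hV : Γ.IsMaximalSingular V) (hdisj : ∀ x ∈ U, x ∉ V) : Γ.Opposite U V := by
  constructor
  · intro x hx
    by_contra! hc
    exact hdisj x hx (hV.mem_of_mem_perp hc)
  · intro y hy
    by_contra! hc
    exact hdisj y (hU.mem_of_mem_perp fun x hx => (hc x hx).symm) hy

/-- `A` contains a point `x` collinear to all of `θ '' L`, and `A` is opposite every plane through
`θ '' L` other than the span `K` of `x` and `θ '' L`. If `K` were `θ '' B`, then `A` would be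
opposite `θ '' A`, which only lines may be. -/
theorem OnlyLinesToOpposite.opposite_planes (ho : Γ.OnlyLinesToOpposite θ) (hrank : Γ.HasRank 3)
    (hθ : Γ.IsCollineation θ) (hh : Γ.IsHyperbolic 3) {L : Set P} (hL : L ∈ Γ.lines)
    (hLo : Γ.Opposite L (θ '' L)) {A B : Set P} (hA : Γ.IsMaximalSingular A)
    (hB : Γ.IsMaximalSingular B) (hAB : A ≠ B) (hLA : L ⊆ A) (hLB : L ⊆ B) :
    Γ.Opposite A (θ '' B) := by
  have hθA := hrank.isMaximalSingular_image hθ hA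
  have hθB := hrank.isMaximalSingular_image hθ hB
  have hL' := hθ.image_line hL
  have hLs := isSingular_line hL
  have hLs' := isSingular_line hL'
  have h1 := hA.1.dim_inter_perp hLs' isSingular_empty (Set.empty_subset _)
  rw [perp_empty, Set.inter_univ, hrank.dim_eq hA, dim_empty, dim_line hL'] at h1
  obtain ⟨x, hxA, hxp⟩ : (A ∩ Γ.perp (θ '' L)).Nonempty := by
    rw [Set.nonempty_iff_ne_empty]
    intro h
    rw [h, dim_empty] at h1
    omega
  have hdisj : ∀ z ∈ L, z ∉ Γ.perp (θ '' L) := fun z hz hzp => by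
    obtain ⟨w, hw, hzw⟩ := hLo.1 z hz
    exact hzw (hzp w hw)
  have hxL : x ∉ L := fun h => hdisj x h hxp
  have hLA' : θ '' L ⊆ θ '' A := Set.image_mono hLA
  have hLB' : θ '' L ⊆ θ '' B := Set.image_mono hLB
  have hAB' : θ '' A ≠ θ '' B := fun h => hAB (θ.injective.image_injective h)
  have hxL' : x ∉ θ '' L := by
    intro hx
    obtain ⟨w, hw, hxw⟩ := hLo.2 x hx
    exact hxw (hA.1.2 w (hLA hw) x hxA)
  have hK := hrank.isMaximalSingular (hLs'.cl_insert hxp)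
    (by rw [hLs'.dim_cl_insert hxp hxL', dim_line hL'])
  set K := Γ.cl (insert x (θ '' L)) with hKdef
  have key : ∀ K', Γ.IsMaximalSingular K' → θ '' L ⊆ K' → K' ≠ K → Γ.Opposite A K' := by
    intro K' hK' hLK' hne
    refine hA.opposite hK' fun z hzA hzK' => ?_
    have hzp : z ∈ Γ.perp (θ '' L) := perp_anti hLK' (hK'.1.subset_perp hzK')
    by_cases hzx : x = z
    · subst hzx
      exact hne (Set.Subset.antisymm (hK.2 hK'.1 (hK'.1.cl_subset (Set.insert_subset hzK' hLK')))
        (hK'.1.cl_subset (Set.insert_subset hzK' hLK')))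
    · obtain ⟨N, hN, hxN, hzN⟩ := (hA.1.2 x hxA z hzA).exists_line hzx
      obtain ⟨hyp, he⟩ := hA.1.exists_cl_insert_eq hLs hLA
        (by rw [dim_line hL, hrank.dim_eq hA]) hxA hxL
      obtain ⟨u, hu, huN⟩ := hLs.line_meets hyp hxL hN hzx hxN hzN (he.symm ▸ hxA) (he.symm ▸ hzA)
      exact hdisj u hu (isSubspace_perp _ N hN x hxN z hzN hzx hxp hzp huN)
  have hsub := subset_cl_insert (Γ := Γ) x (θ '' L)
  rcases hh.eq_or_eq hLs' (by rw [dim_line hL']) hθA hθB hK hLA' hLB' hsub hAB' with h | h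
  · exact key _ hθB hLB' (fun h' => hAB' (h.symm.trans h'.symm))
  · have hAo := key _ hθA hLA' (fun h' => hAB' (h'.trans h))
    have := dim_line (ho A hA.1 ⟨x, hxA⟩ hAo)
    rw [hrank.dim_eq hA] at this
    omega

/-! ### Types and minimal simplices mapped to opposites -/

theorem IsSingular.rk_add_one_eq_iff {U : Set P} (hU : Γ.IsSingular U) :
    Γ.rk U + 1 = n ↔ Γ.dim U + 1 = n := by
  rw [hU.rk_eq]; exact_mod_cast Iff.rfl

theorem HasRank.isMaximalSingular_iff (hrank : Γ.HasRank n) {U : Set P} (hU : Γ.IsSingular U) :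
    Γ.IsMaximalSingular U ↔ Γ.dim U = n :=
  ⟨hrank.dim_eq, fun h => hrank.isMaximalSingular hU h.ge⟩

theorem HasRank.hasType_iff (hrank : Γ.HasRank n) {M₀ U : Set P} (hM₀ : Γ.IsMaximalSingular M₀)
    {i : Fin n} : Γ.HasType n M₀ U i ↔ Γ.IsVertex n U ∧
      (((Γ.IsHyperbolic n → Γ.dim U ≠ n) ∧ Γ.dim U = i + 1) ∨
      (Γ.IsHyperbolic n ∧ Γ.dim U = n ∧
        ((i.val + 1 = n ∧ (Γ.dim (U ∩ M₀) + n) % 2 = 0) ∨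
          (i.val + 2 = n ∧ (Γ.dim (U ∩ M₀) + n) % 2 = 1)))) := by
  refine and_congr_right fun hv => ?_
  have hU := hv.1
  have hI := hU.inter hM₀.1
  have hle := hrank.dim_le hI
  rw [hrank.isMaximalSingular_iff hU, hU.rk_eq, hI.rk_eq]
  norm_cast
  have h0 : (∃ k, Γ.dim (U ∩ M₀) + 2 * k = n) ↔ (Γ.dim (U ∩ M₀) + n) % 2 = 0 :=
    ⟨by rintro ⟨k, hk⟩; omega, fun h => ⟨(n - Γ.dim (U ∩ M₀)) / 2, by omega⟩⟩
  have h1 : (∃ k, Γ.dim (U ∩ M₀) + (2 * k + 1) = n) ↔ (Γ.dim (U ∩ M₀) + n) % 2 = 1 :=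
    ⟨by rintro ⟨k, hk⟩; omega, fun h => ⟨(n - Γ.dim (U ∩ M₀)) / 2, by omega⟩⟩
  rw [h0, h1]

theorem IsVertex.image (hθ : Γ.IsCollineation θ) {U : Set P} (h : Γ.IsVertex n U) :
    Γ.IsVertex n (θ '' U) := by
  refine ⟨h.1.image hθ, h.2.1.image θ, fun hh => ?_⟩
  have := h.2.2 hh
  rw [Ne, h.1.rk_add_one_eq_iff] at this
  rwa [Ne, (h.1.image hθ).rk_add_one_eq_iff, h.1.dim_image hθ]

/-- Only maximal subspaces in the hyperbolic case need an argument: `M₀` and `θ '' M₀` have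
intersection of even codimension, so they define the same families. -/
theorem IsLinewiseKangaroo.hasType_image (hk : Γ.IsLinewiseKangaroo θ) (hrank : Γ.HasRank n)
    (hθ : Γ.IsCollineation θ) (h : ∀ x, Γ.Collinear x (θ x)) {M₀ U : Set P}
    (hM₀ : Γ.IsMaximalSingular M₀) {i : Fin n} (ht : Γ.HasType n M₀ U i) :
    Γ.HasType n M₀ (θ '' U) i := by
  rw [hrank.hasType_iff hM₀] at ht ⊢
  obtain ⟨hv, ht⟩ := ht
  refine ⟨hv.image hθ, ?_⟩
  rw [hv.1.dim_image hθ]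
  refine ht.imp_right fun ⟨hh, hd, ht⟩ => ⟨hh, hd, ?_⟩
  have hU := (hrank.isMaximalSingular_iff hv.1).2 hd
  have hθU := hrank.isMaximalSingular_image hθ hU
  have hθM := hrank.isMaximalSingular_image hθ hM₀
  have h1 := hh.parity hrank hθU hθM hM₀
  have h2 := hk.dim_inter_image hrank hθ h hM₀
  rw [← Set.image_inter θ.injective, (hU.1.inter hM₀.1).dim_image hθ] at h1
  omega

theorem HasRank.types_line (hrank : Γ.HasRank n) (hn : 3 ≤ n) {M₀ L : Set P}
    (hM₀ : Γ.IsMaximalSingular M₀) (hL : L ∈ Γ.lines) (hv : Γ.IsVertex n L) :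
    {i | ∃ U ∈ ({L} : Set (Set P)), Γ.HasType n M₀ U i} = {i | i.val = 1} := by
  ext i
  simp only [Set.mem_singleton_iff, exists_eq_left, Set.mem_ofPred_eq]
  rw [hrank.hasType_iff hM₀, dim_line hL]
  constructor
  · rintro ⟨-, h | h⟩ <;> omega
  · intro h
    exact ⟨hv, Or.inl ⟨fun _ => by omega, by omega⟩⟩

theorem isVertex_line {L : Set P} (hL : L ∈ Γ.lines) (hn : Γ.IsHyperbolic n → n ≠ 3) :
    Γ.IsVertex n L := by
  refine ⟨isSingular_line hL, nonempty_of_mem_lines hL, fun hh => ?_⟩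
  rw [Ne, (isSingular_line hL).rk_add_one_eq_iff, dim_line hL]
  exact fun h => hn hh h.symm

theorem sentToOpposite_singleton {U : Set P} (hU : Γ.IsVertex n U) (h : Γ.Opposite U (θ '' U)) :
    Γ.SentToOpposite n θ {U} := by
  refine ⟨isSimplex_singleton hU, Set.singleton_nonempty U, ?_⟩
  rw [imageSimplex, Set.image_singleton]
  constructor <;> simpa

theorem minimal_sentToOpposite_singleton {U : Set P} (hU : Γ.IsVertex n U)
    (h : Γ.Opposite U (θ '' U)) : Minimal (Γ.SentToOpposite n θ) {U} := by
  refine ⟨sentToOpposite_singleton hU h, fun T hT hTU => ?_⟩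
  rcases Set.subset_singleton_iff_eq.1 hTU with h1 | h1
  · exact absurd hT.2.1 (Set.not_nonempty_iff_eq_empty.2 h1)
  · exact h1.ge

/-- Opposites have equal dimension, so `U` is opposite the image of itself or of a distinct incident
vertex of equal dimension; the latter occurs only for adjacent maximal subspaces in the hyperbolic
case. -/
theorem SentToOpposite.line_or_adjacent (ho : Γ.OnlyLinesToOpposite θ)
    (hθ : Γ.IsCollineation θ) {S : Set (Set P)} (hS : Γ.SentToOpposite n θ S) {U : Set P}
    (hU : U ∈ S) : (U ∈ Γ.lines ∧ Γ.Opposite U (θ '' U)) ∨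
      (Γ.IsHyperbolic n ∧ Γ.IsMaximalSingular U ∧ ∃ U' ∈ S, Γ.IsMaximalSingular U' ∧
        Γ.dim (U ∩ U') + 1 = n ∧ Γ.Opposite U (θ '' U')) := by
  have hUs := (hS.1.1 U hU).1
  obtain ⟨_, ⟨W, hW, rfl⟩, hUW⟩ := hS.2.2.1 U hU
  have hWs := (hS.1.1 W hW).1
  have hd := hUW.dim_eq hUs (hWs.image hθ)
  rw [hWs.dim_image hθ] at hd
  rcases (hS.1.2 U hU W hW).eq_of_dim_eq hUs hWs hd with h | ⟨hh, hM, hM', hr⟩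
  · subst h
    exact Or.inl ⟨ho U hUs (hS.1.1 U hU).2.1 hUW, hUW⟩
  · exact Or.inr ⟨hh, hM, W, hW, hM', ((hUs.inter hWs).rk_add_one_eq_iff).1 hr, hUW⟩

theorem IsLinewiseKangaroo.types_of_rank_ne_three (hk : Γ.IsLinewiseKangaroo θ)
    (ho : Γ.OnlyLinesToOpposite θ) (hrank : Γ.HasRank n) (hn : 3 ≤ n)
    (hθ : Γ.IsCollineation θ) (hne : θ ≠ 1) (hn3 : Γ.IsHyperbolic n → n ≠ 3) {M₀ : Set P}
    (hM₀ : Γ.IsMaximalSingular M₀) :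
    {T | ∃ S, Minimal (Γ.SentToOpposite n θ) S ∧ T = {i | ∃ U ∈ S, Γ.HasType n M₀ U i}} =
      {{i : Fin n | i.val = 1}} := by
  have h := ho.forall_collinear
  ext T
  rw [Set.mem_singleton_iff]
  constructor
  · rintro ⟨S, hS, rfl⟩
    obtain ⟨U, hU⟩ := hS.1.2.1
    rcases hS.1.line_or_adjacent ho hθ hU with ⟨hUl, hUo⟩ | ⟨hh, hUm, U', -, hU'm, hd, hUo⟩
    · have hv := isVertex_line hUl hn3
      have hSU : S = {U} := Set.Subset.antisymm
        (hS.2 (sentToOpposite_singleton hv hUo) (Set.singleton_subset_iff.2 hU))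
        (Set.singleton_subset_iff.2 hU)
      rw [hSU, hrank.types_line hn hM₀ hUl hv]
    · exact absurd (hk.rank_eq_three hrank hn hθ h hh hUm hU'm hd hUo) (hn3 hh)
  · rintro rfl
    obtain ⟨L, hL, hLo⟩ := exists_line_opposite hθ h hne
    have hv := isVertex_line hL hn3
    exact ⟨{L}, minimal_sentToOpposite_singleton hv hLo, (hrank.types_line hn hM₀ hL hv).symm⟩

/-- Lines are not vertices here, so the simplex consists of planes and contains an adjacent pair.
Adjacent planes lie in different families, hence both plane types occur. -/
theorem SentToOpposite.types_rank_three (ho : Γ.OnlyLinesToOpposite θ) (hrank : Γ.HasRank 3)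
    (hθ : Γ.IsCollineation θ) (hh : Γ.IsHyperbolic 3) {M₀ : Set P}
    (hM₀ : Γ.IsMaximalSingular M₀) {S : Set (Set P)} (hS : Γ.SentToOpposite 3 θ S) :
    {i | ∃ U ∈ S, Γ.HasType 3 M₀ U i} = {i : Fin 3 | i ≠ 0} := by
  have key : ∀ U ∈ S, Γ.IsMaximalSingular U ∧ ∃ U' ∈ S, Γ.IsMaximalSingular U' ∧
      Γ.dim (U ∩ U') + 1 = 3 := by
    intro U hU
    rcases hS.line_or_adjacent ho hθ hU with ⟨hUl, -⟩ | ⟨-, hUm, U', hU', hU'm, hd, -⟩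
    · refine absurd ((isSingular_line hUl).rk_add_one_eq_iff.2 ?_) ((hS.1.1 U hU).2.2 hh)
      rw [dim_line hUl]
    · exact ⟨hUm, U', hU', hU'm, hd⟩
  ext i
  constructor
  · rintro ⟨U, hU, ht⟩ rfl
    rw [hrank.hasType_iff hM₀, hrank.dim_eq (key U hU).1] at ht
    rcases ht with ⟨-, h | h⟩ <;> simp at h
  · intro hi
    obtain ⟨U, hU⟩ := hS.2.1
    obtain ⟨hUm, U', hU', hUm', hd⟩ := key U hU
    have hadj := hh.dim_inter_adjacent hrank hM₀ hUm hUm' hd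
    rw [Set.inter_comm M₀ U, Set.inter_comm M₀ U'] at hadj
    have hmem : ∀ V ∈ S, Γ.IsMaximalSingular V → ((i.val + 1 = 3 ∧ (Γ.dim (V ∩ M₀) + 3) % 2 = 0) ∨
        (i.val + 2 = 3 ∧ (Γ.dim (V ∩ M₀) + 3) % 2 = 1)) → Γ.HasType 3 M₀ V i := by
      intro V hV hVm h
      rw [hrank.hasType_iff hM₀]
      exact ⟨hS.1.1 V hV, Or.inr ⟨hh, hrank.dim_eq hVm, h⟩⟩
    have hi0 : i.val ≠ 0 := fun h => hi (Fin.ext h)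
    have hi3 := i.isLt
    by_cases hU0 : (i.val + 1 = 3 ∧ (Γ.dim (U ∩ M₀) + 3) % 2 = 0) ∨
        (i.val + 2 = 3 ∧ (Γ.dim (U ∩ M₀) + 3) % 2 = 1)
    · exact ⟨U, hU, hmem U hU hUm hU0⟩
    · exact ⟨U', hU', hmem U' hU' hUm' (by omega)⟩

theorem OnlyLinesToOpposite.exists_minimal_pair (ho : Γ.OnlyLinesToOpposite θ)
    (hrank : Γ.HasRank 3) (hθ : Γ.IsCollineation θ) (hh : Γ.IsHyperbolic 3) (hne : θ ≠ 1) :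
    ∃ S, Minimal (Γ.SentToOpposite 3 θ) S := by
  obtain ⟨L, hL, hLo⟩ := exists_line_opposite hθ ho.forall_collinear hne
  have hLs := isSingular_line hL
  obtain ⟨A, B, hAB, he⟩ := hh.exists_pair hLs (by rw [dim_line hL])
  obtain ⟨hA, hLA⟩ : A ∈ {M | Γ.IsMaximalSingular M ∧ L ⊆ M} := he ▸ Or.inl rfl
  obtain ⟨hB, hLB⟩ : B ∈ {M | Γ.IsMaximalSingular M ∧ L ⊆ M} := he ▸ Or.inr rfl
  have hABo := ho.opposite_planes hrank hθ hh hL hLo hA hB hAB hLA hLB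
  have hBAo := ho.opposite_planes hrank hθ hh hL hLo hB hA hAB.symm hLB hLA
  have hd : Γ.dim (A ∩ B) + 1 = 3 := by
    have h1 := (hA.1.inter hB.1).dim_le hLs (Set.subset_inter hLA hLB)
    rw [dim_line hL] at h1
    obtain ⟨x, hxA, hxB⟩ := Set.not_subset.1 fun h => hAB (Set.Subset.antisymm h (hA.2 hB.1 h))
    have h2 := hA.1.dim_lt (hA.1.inter hB.1) Set.inter_subset_left hxA (fun h => hxB h.2)
    rw [hrank.dim_eq hA] at h2
    omega
  have hv : ∀ M, Γ.IsMaximalSingular M → Γ.IsVertex 3 M := fun M hM => by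
    refine ⟨hM.1, ?_, fun _ h => ?_⟩
    · rw [Set.nonempty_iff_ne_empty]
      rintro rfl
      have := hrank.dim_eq hM
      rw [dim_empty] at this
      omega
    · rw [hM.1.rk_add_one_eq_iff, hrank.dim_eq hM] at h
      omega
  have hinc : Γ.Incident 3 A B :=
    Or.inr (Or.inr ⟨hh, hA, hB, (hA.1.inter hB.1).rk_add_one_eq_iff.2 hd⟩)
  have hinc' : Γ.Incident 3 B A :=
    Or.inr (Or.inr ⟨hh, hB, hA, Set.inter_comm A B ▸ (hA.1.inter hB.1).rk_add_one_eq_iff.2 hd⟩)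
  refine ⟨{A, B}, ⟨⟨?_, ?_⟩, ⟨A, Or.inl rfl⟩, ?_⟩, ?_⟩
  · rintro U (rfl | rfl)
    exacts [hv _ hA, hv _ hB]
  · rintro U (rfl | rfl) V (rfl | rfl)
    exacts [Or.inl subset_rfl, hinc, hinc', Or.inl subset_rfl]
  · rw [imageSimplex, Set.image_pair]
    constructor
    · rintro U (rfl | rfl)
      exacts [⟨_, Or.inr rfl, hABo⟩, ⟨_, Or.inl rfl, hBAo⟩]
    · rintro U (rfl | rfl)
      exacts [⟨_, Or.inr rfl, hBAo⟩, ⟨_, Or.inl rfl, hABo⟩]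
  -- Any nonempty part of `{A, B}` sent to opposites already contains two distinct adjacent planes,
  -- so it is all of `{A, B}`.
  · intro T hT hTS
    obtain ⟨U, hU⟩ := hT.2.1
    rcases hT.line_or_adjacent ho hθ hU with ⟨hUl, -⟩ | ⟨-, hUm, U', hU', -, hd', -⟩
    · refine absurd ((isSingular_line hUl).rk_add_one_eq_iff.2 ?_) ((hT.1.1 U hU).2.2 hh)
      rw [dim_line hUl]
    · have hne : U ≠ U' := by
        rintro rfl
        rw [Set.inter_self, hrank.dim_eq hUm] at hd'
        omega
      have h1 := hTS hU
      have h2 := hTS hU'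
      rintro V (rfl | rfl) <;> grind

/-! ### The decorated diagrams and the main theorem -/

theorem swapLastTwo_mul_self (n : ℕ) : swapLastTwo n * swapLastTwo n = 1 := by
  unfold swapLastTwo
  split <;> simp

theorem distinguished_diagramD_of_ne_three (hn : 3 ≤ n) (hn3 : n ≠ 3) :
    (diagramD n).distinguished = {{i : Fin n | i.val = 1}} := by
  have hfix : ∀ i : Fin n, i.val = 1 →
      Function.IsFixedPt (if Even n then 1 else swapLastTwo n : Equiv.Perm (Fin n)) i := by
    intro i hi
    split_ifs with he
    · rfl
    · rw [Nat.not_even_iff] at he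
      rw [swapLastTwo, dif_pos (by omega)]
      exact Equiv.swap_apply_of_ne_of_ne (by rw [Ne, Fin.ext_iff]; dsimp; omega)
        (by rw [Ne, Fin.ext_iff]; dsimp; omega)
  simp only [diagramD, Set.singleton_eq_singleton_iff]
  ext j
  constructor
  · rintro ⟨i, hi, hij⟩
    rwa [← hij.eq_of_left (hfix i hi)]
  · intro hj
    exact ⟨j, hj, .refl _ _⟩

theorem distinguished_diagramD_three :
    (diagramD 3).distinguished = {{i : Fin 3 | i ≠ 0}} := by
  have h3 : ¬ Even 3 := by decide
  have hsw : swapLastTwo 3 = Equiv.swap 1 2 := rfl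
  simp only [diagramD, if_neg h3, hsw, Set.singleton_eq_singleton_iff]
  ext j
  constructor
  · rintro ⟨i, hi, hij⟩ hj
    have hj' : Function.IsFixedPt (Equiv.swap 1 2 : Equiv.Perm (Fin 3)) j := by rw [hj]; rfl
    rw [hij.eq_of_right hj', hj] at hi
    exact absurd hi (by decide)
  · intro hj
    refine ⟨1, rfl, ?_⟩
    fin_cases j
    · exact absurd rfl hj
    · exact .refl _ _
    · exact ⟨1, rfl⟩

end PolarSpace

theorem mainTheorem11 {P : Type*} (Γ : PolarSpace P) (n : ℕ) (hn : 3 ≤ n) (hrank : Γ.HasRank n)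
    (θ : Equiv.Perm P) (hθ : Γ.IsCollineation θ) (hne : θ ≠ 1) :
    (Γ.IsLinewiseKangaroo θ ↔ Γ.IsAnisotropic n θ ∨ Γ.OnlyLinesToOpposite θ) ∧
    (Γ.IsLinewiseKangaroo θ → ¬ Γ.IsAnisotropic n θ →
      ∀ M₀, Γ.IsMaximalSingular M₀ →
        (¬ Γ.IsHyperbolic n → Γ.IsOppositionDiagram n M₀ θ (diagramB n)) ∧
        (Γ.IsHyperbolic n → Γ.IsOppositionDiagram n M₀ θ (diagramD n))) := by
  refine ⟨⟨fun hk => ?_, ?_⟩, fun hk ha M₀ hM₀ => ?_⟩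
  · by_cases ha : Γ.IsAnisotropic n θ
    · exact Or.inl ha
    · exact Or.inr (hk.onlyLinesToOpposite hθ (hk.forall_collinear hrank hn hθ ha))
  · rintro (ha | ho)
    · exact fun L _ => Or.inr (PolarSpace.opposite_image_of_forall_not_collinear
        ((PolarSpace.isAnisotropic_iff hrank hn hθ).1 ha) L)
    · exact ho.isLinewiseKangaroo hrank hn hθ
  · have h := hk.forall_collinear hrank hn hθ ha
    have ho := hk.onlyLinesToOpposite hθ h
    have hcomp : Γ.IsCompanion n M₀ θ 1 := fun U i ht => hk.hasType_image hrank hθ h hM₀ ht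
    refine ⟨fun hh => ⟨?_, ?_, ?_⟩, fun hh => ⟨?_, ?_, ?_⟩⟩
    · simp [PolarSpace.coxeterMatrix, hh, diagramB]
    · simpa [PolarSpace.oppositionRelation, hh, diagramB] using hcomp
    · exact (hk.types_of_rank_ne_three ho hrank hn hθ hne (fun h => absurd h hh) hM₀).symm
    · simp [PolarSpace.coxeterMatrix, hh, diagramD]
    · have h1 : (diagramD n).twist * Γ.oppositionRelation n = 1 := by
        by_cases he : Even n
        · simp [diagramD, PolarSpace.oppositionRelation, he]
        · simp [diagramD, PolarSpace.oppositionRelation, he, hh, Nat.not_even_iff_odd.1 he,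
            PolarSpace.swapLastTwo_mul_self]
      rwa [h1]
    · by_cases hn3 : n = 3
      · subst hn3
        rw [PolarSpace.distinguished_diagramD_three]
        ext T
        rw [Set.mem_singleton_iff]
        constructor
        · rintro rfl
          obtain ⟨S, hS⟩ := ho.exists_minimal_pair hrank hθ hh hne
          exact ⟨S, hS, (hS.1.types_rank_three ho hrank hθ hh hM₀).symm⟩
        · rintro ⟨S, hS, rfl⟩
          exact hS.1.types_rank_three ho hrank hθ hh hM₀
      · rw [PolarSpace.distinguished_diagramD_of_ne_three hn hn3]
        exact (hk.types_of_rank_ne_three ho hrank hn hθ hne (fun _ => hn3) hM₀).symm
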